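/- Let $G$ be a (finite-dimensional) Lie group with Lie algebra $\mathfrak g=T_eG$ acting smoothly on the left on a finite-dimensional smooth manifold $Q$ so that the quotient map $\pi:Q\to Q/G$ is a smooth principal $G$-bundle. Let $G$ act diagonally on $Q\times Q$. Let $\mathcal A_d:Q\times Q\to G$ be an affine discrete connection on $\pi$: a smooth map with $\mathcal A_d(g_0q_0,g_1q_1)=g_1\,\mathcal A_d(q_0,q_1)\,g_0^{-1}$ for all $q_0,q_1\in Q$, $g_0,g_1\in G$, together with a smooth map $\gamma:Q\to G$ (its level) such that $\gamma(gq)=g\gamma(q)g^{-1}$ and $\mathcal A_d(q,\gamma(q)q)=e$. Let $\tilde{\mathfrak A}:T(Q\times Q)\to\mathfrak g$ be a principal connection on $\tilde\pi:Q\times Q\to(Q\times Q)/G$, i.e. a smooth $\mathfrak g$-valued $1$-form with $\tilde{\mathfrak A}(\xi_{Q\times Q}(x))=\xi$ for all $\xi\in\mathfrak g$, $x\in Q\times Q$, where $\xi_{Q\times Q}$ is the infinitesimal generator, and $\tilde{\mathfrak A}(Tl_g v)=\operatorname{Ad}_g\tilde{\mathfrak A}(v)$, where $l_g$ is the diagonal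 action of $g$. Let $\tilde G:=(Q\times G)/G$ be the conjugate bundle, where $g\cdot(q,w)=(gq,gwg^{-1})$, with quotient map $\rho:Q\times G\to\tilde G$, and set $$\Upsilon:Q\times Q\to\tilde G\times Q/G,\qquad \Upsilon(q_0,q_1)=(\rho(q_0,\mathcal A_d(q_0,q_1)),\pi(q_1)).$$ Let $\tilde{\mathfrak g}=(Q\times Q\times\mathfrak g)/G$ be the adjoint bundle of $\tilde\pi$, and let $\hat{\mathfrak g}$ be its pullback to $\tilde G\times Q/G$ under the diffeomorphism $\tilde G\times Q/G\cong(Q\times Q)/G$ induced by $\Upsilon$; thus $\hat{\mathfrak g}$ is the vector bundle over $\tilde G\times Q/G$ whose fibre over $(v_0,\tau_1)$ consists of the classes $[(q_0,q_1),\xi]$ with $\Upsilon(q_0,q_1)=(v_0,\tau_1)$. Let $f_d:Q\times Q\to T^*(Q\times Q)$ be a smooth section that is $G$-equivariant for the cotangent lift of the diagonal action. Then there is a unique smooth section $$\hat f_d:\tilde G\times Q/G\to T^*(\tilde G\times Q/G)\oplus\hat{\mathfrak g}^*$$ such that, for all $(q_0,q_1)\in Q\times Q$ and $(\delta q_0,\delta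 q_1)\in T_{(q_0,q_1)}(Q\times Q)$, $$\hat f_d(\Upsilon(q_0,q_1))\bigl(T\Upsilon(\delta q_0,\delta q_1)\oplus[(q_0,q_1),\tilde{\mathfrak A}(\delta q_0,\delta q_1)]\bigr)=f_d(q_0,q_1)(\delta q_0,\delta q_1).$$ Moreover, for each $(q_0,q_1)$, every element of the fibre of $T(\tilde G\times Q/G)\oplus\hat{\mathfrak g}$ over $\Upsilon(q_0,q_1)$ is of the form $T\Upsilon(\delta q_0,\delta q_1)\oplus[(q_0,q_1),\tilde{\mathfrak A}(\delta q_0,\delta q_1)]$ for exactly one $(\delta q_0,\delta q_1)\in T_{(q_0,q_1)}(Q\times Q)$, so that the formula determines each value of $\hat f_d$. -/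

import Mathlib

open scoped Manifold ContDiff Topology
open Bundle Set Topology

set_option linter.unusedSectionVars false

namespace DiscreteReduction

/-! ### Lie group actions, adjoint action, principal connections -/

section Actions

variable {EG : Type*} [NormedAddCommGroup EG] [NormedSpace ℝ EG]
  {G : Type*} [TopologicalSpace G] [ChartedSpace EG G] [Group G]

/-- The adjoint action `Ad g` of `g` on the Lie algebra `𝔤 = T₁G`: the differential at `1` of the
conjugation `x ↦ g x g⁻¹`. -/
noncomputable def Ad (g : G) :
    GroupLieAlgebra 𝓘(ℝ, EG) G →L[ℝ] GroupLieAlgebra 𝓘(ℝ, EG) G :=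
  mfderiv 𝓘(ℝ, EG) 𝓘(ℝ, EG) (fun x : G => g * x * g⁻¹) 1

lemma Ad_one : Ad (EG := EG) (1 : G) = ContinuousLinearMap.id ℝ _ := by
  have : (fun x : G => 1 * x * 1⁻¹) = id := by ext; simp
  unfold Ad
  rw [this]
  exact mfderiv_id

lemma Ad_mul [LieGroup 𝓘(ℝ, EG) ∞ G] (g h : G) :
    Ad (EG := EG) (g * h) = (Ad g).comp (Ad h) := by
  have hs : ∀ k : G, ContMDiff 𝓘(ℝ, EG) 𝓘(ℝ, EG) ∞ (fun x : G => k * x * k⁻¹) := fun k =>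
    (contMDiff_const.mul contMDiff_id).mul contMDiff_const
  have hd : ∀ k x : G, MDifferentiableAt 𝓘(ℝ, EG) 𝓘(ℝ, EG) (fun x : G => k * x * k⁻¹) x :=
    fun k x => (hs k).mdifferentiable (by simp) x
  have key : ∀ y : G, y = 1 → (mfderiv 𝓘(ℝ, EG) 𝓘(ℝ, EG) (fun x : G => g * x * g⁻¹) y : EG →L[ℝ] EG)
      = mfderiv 𝓘(ℝ, EG) 𝓘(ℝ, EG) (fun x : G => g * x * g⁻¹) 1 := by
    rintro y rfl; rfl
  have hc : (fun x : G => (g * h) * x * (g * h)⁻¹)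
      = (fun x : G => g * x * g⁻¹) ∘ (fun x : G => h * x * h⁻¹) := by
    ext x; simp [mul_assoc]
  have h1 := mfderiv_comp (1 : G) (hd g (h * 1 * h⁻¹)) (hd h 1)
  rw [← hc] at h1
  refine h1.trans ?_
  have h2 := key (h * 1 * h⁻¹) (by simp)
  exact congrArg (fun L : EG →L[ℝ] EG =>
    L.comp (mfderiv 𝓘(ℝ, EG) 𝓘(ℝ, EG) (fun x : G => h * x * h⁻¹) 1 : EG →L[ℝ] EG)) h2

lemma Ad_inv_Ad [LieGroup 𝓘(ℝ, EG) ∞ G] (g : G) (ξ : GroupLieAlgebra 𝓘(ℝ, EG) G) :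
    Ad g⁻¹ (Ad g ξ) = ξ := by
  have := Ad_mul (EG := EG) g⁻¹ g
  rw [inv_mul_cancel, Ad_one] at this
  exact (DFunLike.congr_fun this ξ).symm

lemma Ad_Ad_inv [LieGroup 𝓘(ℝ, EG) ∞ G] (g : G) (ξ : GroupLieAlgebra 𝓘(ℝ, EG) G) :
    Ad g (Ad g⁻¹ ξ) = ξ := by
  have := Ad_mul (EG := EG) g g⁻¹
  rw [mul_inv_cancel, Ad_one] at this
  exact (DFunLike.congr_fun this ξ).symm

/-- `Ad g` as an endomorphism of the model space `EG`, which underlies `T₁G`. -/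
noncomputable def AdModel (g : G) : EG →L[ℝ] EG := Ad (EG := EG) g

lemma contMDiff_AdModel [LieGroup 𝓘(ℝ, EG) ∞ G] :
    ContMDiff 𝓘(ℝ, EG) 𝓘(ℝ, EG →L[ℝ] EG) ∞ (AdModel : G → (EG →L[ℝ] EG)) := by
  intro g₀
  have : IsManifold 𝓘(ℝ, EG) ∞ G := inferInstance
  have hf : ContMDiff (𝓘(ℝ, EG).prod 𝓘(ℝ, EG)) 𝓘(ℝ, EG) ∞
      (Function.uncurry (fun g x : G => g * x * g⁻¹)) :=
    (contMDiff_fst.mul contMDiff_snd).mul contMDiff_fst.inv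
  have h := ContMDiffAt.mfderiv (m := ∞) (n := ∞) (x₀ := g₀) (fun g x : G => g * x * g⁻¹)
    (fun _ : G => (1 : G)) (hf _) contMDiffAt_const (by simp)
  refine h.congr_of_eventuallyEq (Filter.Eventually.of_forall fun g => ?_)
  have e1 : g * 1 * g⁻¹ = g₀ * 1 * g₀⁻¹ := by simp
  have cc : ∀ a b : G, a = b → ∀ v : EG,
      (tangentBundleCore 𝓘(ℝ, EG) G).coordChange (achart EG a) (achart EG b) a v = v := by
    rintro a _ rfl v
    exact (tangentBundleCore 𝓘(ℝ, EG) G).coordChange_self _ _ (mem_chart_source EG a) v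
  refine Eq.trans ?_ (inTangentCoordinates_eq (I := 𝓘(ℝ, EG)) (I' := 𝓘(ℝ, EG))
    (fun _ : G => (1 : G)) (fun x : G => x * 1 * x⁻¹) AdModel (x₀ := g₀) (x := g)
    (mem_chart_source EG (1 : G)) ?_).symm
  swap
  · simp only [e1]; exact mem_chart_source EG _
  ext v
  have a1 := cc 1 1 rfl v
  have a2 := cc _ _ e1 (AdModel g v)
  refine a2.symm.trans ?_
  refine congrArg ((tangentBundleCore 𝓘(ℝ, EG) G).coordChange _ _ _) ?_
  exact congrArg (AdModel g) a1.symm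

variable {E : Type*} [NormedAddCommGroup E] [NormedSpace ℝ E] {H : Type*} [TopologicalSpace H]
  (I : ModelWithCorners ℝ E H) {M : Type*} [TopologicalSpace M] [ChartedSpace H M] [MulAction G M]

/-- The infinitesimal generator `ξ_M` at `x`: the velocity at `1` of the orbit map `g ↦ g • x` in
the direction `ξ`. The target is `T_{1 • x} M = T_x M`. -/
noncomputable def infGenerator (ξ : GroupLieAlgebra 𝓘(ℝ, EG) G) (x : M) : TangentSpace I x :=
  (mfderiv 𝓘(ℝ, EG) I (fun g : G => g • x) 1 : EG →L[ℝ] E) ξ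

variable (EG G M) in
/-- A principal connection for an action of `G` on `M` (the total space of a principal `G`-bundle):
a smooth `𝔤`-valued `1`-form (the model space `EG` underlies `𝔤 = T₁G`) that reproduces the
infinitesimal generators and is `Ad`-equivariant. -/
structure PrincipalConnection [IsManifold I ∞ M] where
  form : Cₛ^∞⟮I; E →L[ℝ] EG, fun x : M => TangentSpace I x →L[ℝ] Bundle.Trivial M EG x⟯
  form_infGenerator : ∀ (ξ : GroupLieAlgebra 𝓘(ℝ, EG) G) (x : M),
    form x (infGenerator I ξ x) = (ξ : EG)
  form_smul : ∀ (g : G) (x : M) (v : TangentSpace I x),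
    form (g • x) (mfderiv I I (fun y : M => g • y) x v) =
      (Ad g (form x v : GroupLieAlgebra 𝓘(ℝ, EG) G) : EG)

/-- The value of a principal connection on a tangent vector, as an element of `𝔤`. -/
noncomputable def PrincipalConnection.apply {I : ModelWithCorners ℝ E H} [IsManifold I ∞ M] (𝔄 : PrincipalConnection EG G I M)
    (x : M) (v : TangentSpace I x) : GroupLieAlgebra 𝓘(ℝ, EG) G :=
  𝔄.form x v

variable (M) in
/-- Smooth `1`-forms, i.e. smooth sections of the cotangent bundle `T*M`. -/
abbrev OneForm [IsManifold I ∞ M] : Type _ :=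
  Cₛ^∞⟮I; E →L[ℝ] ℝ, fun x : M => TangentSpace I x →L[ℝ] Bundle.Trivial M ℝ x⟯

/-- The cotangent lift of the action: `(g • α)(v) = α(T l_{g⁻¹} v)` for `α ∈ T*_x M` and
`v ∈ T_{g • x} M`; here `T l_{g⁻¹}` takes values in `T_{g⁻¹ • g • x} M = T_x M`. -/
noncomputable def cotangentLift (g : G) (x : M) (α : TangentSpace I x →L[ℝ] ℝ) :
    TangentSpace I (g • x) →L[ℝ] ℝ :=
  (α : E →L[ℝ] ℝ).comp (mfderiv I I (fun y : M => g⁻¹ • y) (g • x) : E →L[ℝ] E)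

variable (G) in
/-- `G`-equivariance of a section of `T*M`. -/
def OneForm.IsEquivariant [IsManifold I ∞ M] (f : OneForm I M) : Prop :=
  ∀ (g : G) (x : M), f (g • x) = cotangentLift I g x (f x)

end Actions

/-! ### Orbit spaces -/

section Orbits

/-- The orbit map `π : Q → Q/G`. -/
def orbitMap (G Q : Type*) [Group G] [MulAction G Q] (q : Q) : MulAction.orbitRel.Quotient G Q :=
  Quotient.mk _ q

/-- The orbit relation of the action `g • (q, w) = (g • q, g w g⁻¹)` of `G` on `Q × G`. -/
def conjugateSetoid (G Q : Type*) [Group G] [MulAction G Q] : Setoid (Q × G) where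
  r a b := ∃ g : G, g • b.1 = a.1 ∧ g * b.2 * g⁻¹ = a.2
  iseqv :=
    { refl := fun a => ⟨1, by simp, by simp⟩
      symm := by
        rintro a b ⟨g, h1, h2⟩
        exact ⟨g⁻¹, by rw [← h1, inv_smul_smul], by rw [← h2]; group⟩
      trans := by
        rintro a b c ⟨g, h1, h2⟩ ⟨k, h3, h4⟩
        exact ⟨g * k, by rw [mul_smul, h3, h1], by rw [← h2, ← h4]; group⟩ }

/-- The conjugate bundle `G̃ = (Q × G)/G`, `G` acting on `Q × G` by `g • (q, w) = (g • q, g w g⁻¹)`.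
The model space of `Q` is a parameter only so that instance search can find the smooth structure. -/
def ConjugateBundle (_EQ G Q : Type*) [Group G] [MulAction G Q] : Type _ :=
  Quotient (conjugateSetoid G Q)

variable {EQ G Q : Type*} [Group G] [MulAction G Q]

lemma orbitMap_smul (g : G) (q : Q) : orbitMap G Q (g • q) = orbitMap G Q q :=
  Quotient.sound ⟨g, rfl⟩

lemma orbitMap_eq_iff {q q' : Q} : orbitMap G Q q = orbitMap G Q q' ↔ ∃ g : G, g • q' = q := by
  unfold orbitMap
  rw [Quotient.eq, MulAction.orbitRel_apply, MulAction.mem_orbit_iff]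

lemma exists_orbitMap_eq (b : MulAction.orbitRel.Quotient G Q) : ∃ q, orbitMap G Q q = b :=
  Quotient.exists_rep b

namespace ConjugateBundle

/-- The quotient map `ρ : Q × G → G̃`. -/
def mk (EQ : Type*) {G Q : Type*} [Group G] [MulAction G Q] (q : Q) (w : G) :
    ConjugateBundle EQ G Q :=
  Quotient.mk (conjugateSetoid G Q) (q, w)

lemma mk_eq_iff {q q' : Q} {w w' : G} :
    mk EQ q w = mk EQ q' w' ↔ ∃ g : G, g • q' = q ∧ g * w' * g⁻¹ = w :=
  Quotient.eq (r := conjugateSetoid G Q)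

/-- The bundle projection `G̃ → Q/G`, `ρ(q, w) ↦ π(q)`. -/
def proj (v : ConjugateBundle EQ G Q) : MulAction.orbitRel.Quotient G Q :=
  Quotient.lift (s := conjugateSetoid G Q) (fun a : Q × G => orbitMap G Q a.1)
    (fun _ _ h => orbitMap_eq_iff.2 (h.imp fun _ hg => hg.1)) v

@[simp] lemma proj_mk (q : Q) (w : G) : proj (mk EQ q w) = orbitMap G Q q := rfl

lemma exists_rep (v : ConjugateBundle EQ G Q) : ∃ (q : Q) (w : G), mk EQ q w = v := by
  obtain ⟨a, rfl⟩ := Quotient.exists_rep v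
  exact ⟨a.1, a.2, rfl⟩

variable [TopologicalSpace Q]

lemma _root_.DiscreteReduction.continuous_orbitMap : Continuous (orbitMap G Q) :=
  continuous_quotient_mk'

variable [TopologicalSpace G]

/-- The quotient topology on `G̃`. -/
instance : TopologicalSpace (ConjugateBundle EQ G Q) :=
  inferInstanceAs (TopologicalSpace (Quotient (conjugateSetoid G Q)))

lemma isQuotientMap_mk : IsQuotientMap (fun a : Q × G => mk EQ a.1 a.2) :=
  isQuotientMap_quotient_mk'

lemma continuous_proj : Continuous (proj : ConjugateBundle EQ G Q → _) := by
  rw [isQuotientMap_mk.continuous_iff]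
  exact continuous_orbitMap.comp continuous_fst

end ConjugateBundle

end Orbits

/-! ### Smooth principal bundles -/

section Principal

variable {EG : Type*} [NormedAddCommGroup EG] [NormedSpace ℝ EG]
  {EQ : Type*} [NormedAddCommGroup EQ] [NormedSpace ℝ EQ]
  {EB : Type*} [NormedAddCommGroup EB] [NormedSpace ℝ EB]
  {G : Type*} [TopologicalSpace G] [ChartedSpace EG G] [Group G]
  {Q : Type*} [TopologicalSpace Q] [ChartedSpace EQ Q] [MulAction G Q]
  [ChartedSpace EB (MulAction.orbitRel.Quotient G Q)]

variable (EG EQ EB) in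
/-- A local trivialization `π⁻¹(U) ≃ U × G` of the orbit map that is a `G`-equivariant
diffeomorphism, `G` acting on `U × G` by left translations of the second factor. -/
structure IsPrincipalTrivialization (e : Trivialization G (orbitMap G Q)) : Prop where
  equivariant : ∀ (g : G) (q : Q), q ∈ e.source → (e (g • q)).2 = g * (e q).2
  contMDiffOn : ContMDiffOn 𝓘(ℝ, EQ) (𝓘(ℝ, EB).prod 𝓘(ℝ, EG)) ∞ e e.source
  contMDiffOn_symm :
    ContMDiffOn (𝓘(ℝ, EB).prod 𝓘(ℝ, EG)) 𝓘(ℝ, EQ) ∞ e.toOpenPartialHomeomorph.symm e.target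

/-- The action of `G` on `Q` is smooth and `π : Q → Q/G` is a smooth principal `G`-bundle, for the
given smooth structures of `G` (modelled on `EG`), `Q` (modelled on `EQ`) and `Q/G` (modelled
on `EB`). -/
class IsPrincipalBundle (EG EQ EB : Type*) [NormedAddCommGroup EG] [NormedSpace ℝ EG]
    [NormedAddCommGroup EQ] [NormedSpace ℝ EQ] [NormedAddCommGroup EB] [NormedSpace ℝ EB]
    (G Q : Type*) [TopologicalSpace G] [ChartedSpace EG G] [Group G]
    [TopologicalSpace Q] [ChartedSpace EQ Q] [MulAction G Q]
    [ChartedSpace EB (MulAction.orbitRel.Quotient G Q)] : Prop where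
  contMDiff_smul : ContMDiff (𝓘(ℝ, EG).prod 𝓘(ℝ, EQ)) 𝓘(ℝ, EQ) ∞ (fun p : G × Q => p.1 • p.2)
  exists_trivialization : ∀ b : MulAction.orbitRel.Quotient G Q,
    ∃ e : Trivialization G (orbitMap G Q), b ∈ e.baseSet ∧ IsPrincipalTrivialization EG EQ EB e

/-- The local section of `π` on the base set of a trivialization with second component `1`. -/
noncomputable def localSection (e : Trivialization G (orbitMap G Q))
    (b : MulAction.orbitRel.Quotient G Q) : Q := e.toOpenPartialHomeomorph.symm (b, 1)

/-- The transition function between two trivializations. -/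
noncomputable def transition (e e' : Trivialization G (orbitMap G Q))
    (b : MulAction.orbitRel.Quotient G Q) : G := (e' (localSection e b)).2

namespace IsPrincipalTrivialization

variable {e e' : Trivialization G (orbitMap G Q)} {b : MulAction.orbitRel.Quotient G Q} {q : Q}

lemma apply_localSection (hb : b ∈ e.baseSet) : e (localSection e b) = (b, 1) :=
  e.apply_symm_apply (by rw [e.mem_target]; exact hb)

lemma localSection_mem (hb : b ∈ e.baseSet) : localSection e b ∈ e.source :=
  e.toOpenPartialHomeomorph.map_target (by rw [e.mem_target]; exact hb)

lemma orbitMap_localSection (hb : b ∈ e.baseSet) : orbitMap G Q (localSection e b) = b := by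
  rw [← e.proj_toFun _ (localSection_mem hb)]
  exact congrArg Prod.fst (apply_localSection hb)

lemma smul_mem (g : G) (hq : q ∈ e.source) : g • q ∈ e.source := by
  rw [e.mem_source] at hq ⊢
  rwa [orbitMap_smul]

lemma smul_localSection (he : IsPrincipalTrivialization EG EQ EB e) (hq : q ∈ e.source) :
    (e q).2 • localSection e (orbitMap G Q q) = q := by
  have hb : orbitMap G Q q ∈ e.baseSet := e.mem_source.1 hq
  refine e.toOpenPartialHomeomorph.injOn (smul_mem _ (localSection_mem hb)) hq ?_
  refine Prod.ext ?_ ?_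
  · rw [e.proj_toFun _ (smul_mem _ (localSection_mem hb)), e.proj_toFun _ hq, orbitMap_smul,
      orbitMap_localSection hb]
  · refine (he.equivariant _ _ (localSection_mem hb)).trans ?_
    rw [apply_localSection hb, mul_one]
    rfl

lemma snd_eq_mul_transition (he : IsPrincipalTrivialization EG EQ EB e)
    (he' : IsPrincipalTrivialization EG EQ EB e') (hq : q ∈ e.source) (hq' : q ∈ e'.source) :
    (e' q).2 = (e q).2 * transition e e' (orbitMap G Q q) := by
  have hb : orbitMap G Q q ∈ e.baseSet := e.mem_source.1 hq
  have hb' : orbitMap G Q q ∈ e'.baseSet := e'.mem_source.1 hq'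
  conv_lhs => rw [← he.smul_localSection hq]
  exact he'.equivariant _ _ (by rw [e'.mem_source, orbitMap_localSection hb]; exact hb')

lemma contMDiffOn_localSection (he : IsPrincipalTrivialization EG EQ EB e) :
    ContMDiffOn 𝓘(ℝ, EB) 𝓘(ℝ, EQ) ∞ (localSection e) e.baseSet :=
  he.contMDiffOn_symm.comp (t := e.target) (contMDiffOn_id.prodMk contMDiffOn_const)
    (fun b hb => by rw [mem_preimage, e.mem_target]; exact hb)

lemma contMDiffOn_transition (he : IsPrincipalTrivialization EG EQ EB e)
    (he' : IsPrincipalTrivialization EG EQ EB e') :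
    ContMDiffOn 𝓘(ℝ, EB) 𝓘(ℝ, EG) ∞ (transition e e') (e.baseSet ∩ e'.baseSet) :=
  contMDiff_snd.comp_contMDiffOn (he'.contMDiffOn.comp
    (he.contMDiffOn_localSection.mono inter_subset_left)
    (fun b hb => by rw [mem_preimage, e'.mem_source, orbitMap_localSection hb.1]; exact hb.2))

end IsPrincipalTrivialization

section

variable [IsPrincipalBundle EG EQ EB G Q]

variable (EG EQ EB) in
/-- A chosen smooth trivialization around a point of `Q/G`. -/
noncomputable def trivAt (b : MulAction.orbitRel.Quotient G Q) : Trivialization G (orbitMap G Q) :=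
  (IsPrincipalBundle.exists_trivialization (EG := EG) (EQ := EQ) (EB := EB) b).choose

lemma mem_trivAt (b : MulAction.orbitRel.Quotient G Q) : b ∈ (trivAt EG EQ EB b).baseSet :=
  (IsPrincipalBundle.exists_trivialization (EG := EG) (EQ := EQ) (EB := EB) b).choose_spec.1

lemma isPrincipal_trivAt (b : MulAction.orbitRel.Quotient G Q) :
    IsPrincipalTrivialization EG EQ EB (trivAt EG EQ EB b) :=
  (IsPrincipalBundle.exists_trivialization (EG := EG) (EQ := EQ) (EB := EB) b).choose_spec.2

end

/-! ### The smooth structure of the conjugate bundle -/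

namespace ConjugateBundle

open IsPrincipalTrivialization

variable [LieGroup 𝓘(ℝ, EG) ∞ G] {e e' : Trivialization G (orbitMap G Q)}

/-- The second component of `G̃|_U → U × G`, `ρ(q, w) ↦ (π(q), k⁻¹ w k)`, where `e q = (π(q), k)`. -/
noncomputable def coord (e : Trivialization G (orbitMap G Q)) (v : ConjugateBundle EQ G Q) : G :=
  (e (Quotient.out v).1).2⁻¹ * (Quotient.out v).2 * (e (Quotient.out v).1).2

lemma coord_mk (he : IsPrincipalTrivialization EG EQ EB e) {q : Q} (hq : q ∈ e.source) (w : G) :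
    coord e (mk EQ q w) = (e q).2⁻¹ * w * (e q).2 := by
  have h : mk EQ (Quotient.out (mk EQ q w)).1 (Quotient.out (mk EQ q w)).2 = mk EQ q w :=
    Quotient.out_eq (mk EQ q w)
  obtain ⟨g, h1, h2⟩ := mk_eq_iff.1 h
  unfold coord
  rw [← h1, ← h2, he.equivariant g q hq]
  group

/-- The local trivialization `G̃|_U ≃ U × G` induced by a trivialization of `π` over `U`. -/
noncomputable def localTriv (e : Trivialization G (orbitMap G Q))
    (he : IsPrincipalTrivialization EG EQ EB e) :
    OpenPartialHomeomorph (ConjugateBundle EQ G Q) (MulAction.orbitRel.Quotient G Q × G) where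
  toFun v := (proj v, coord e v)
  invFun p := mk EQ (localSection e p.1) p.2
  source := proj ⁻¹' e.baseSet
  target := e.baseSet ×ˢ univ
  map_source' v hv := ⟨hv, mem_univ _⟩
  map_target' p hp := by
    rw [mem_preimage, proj_mk, orbitMap_localSection hp.1]; exact hp.1
  left_inv' v hv := by
    obtain ⟨q, w, rfl⟩ := exists_rep v
    have hq : q ∈ e.source := e.mem_source.2 hv
    simp only [proj_mk, coord_mk he hq]
    exact mk_eq_iff.2 ⟨(e q).2⁻¹, by rw [inv_smul_eq_iff]; exact (he.smul_localSection hq).symm,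
      by group⟩
  right_inv' p hp := by
    refine Prod.ext (orbitMap_localSection hp.1) ?_
    simp [coord_mk he (localSection_mem hp.1), apply_localSection hp.1]
  open_source := e.open_baseSet.preimage continuous_proj
  open_target := e.open_baseSet.prod isOpen_univ
  continuousOn_toFun := by
    refine continuous_proj.continuousOn.prodMk ?_
    rw [isQuotientMap_mk.continuousOn_isOpen_iff (e.open_baseSet.preimage continuous_proj)]
    have := topologicalGroup_of_lieGroup 𝓘(ℝ, EG) ∞ (G := G)
    have h : ContinuousOn (fun a : Q × G => (e a.1).2) (Prod.fst ⁻¹' e.source) :=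
      continuous_snd.comp_continuousOn
        (e.toOpenPartialHomeomorph.continuousOn.comp continuousOn_fst (fun _ h => h))
    refine ContinuousOn.congr (f := fun a : Q × G => (e a.1).2⁻¹ * a.2 * (e a.1).2) ?_ ?_
    · exact ((h.inv.mul continuousOn_snd).mul h).mono fun a ha => e.mem_source.2 ha
    · intro a ha
      exact coord_mk he (e.mem_source.2 ha) a.2
  continuousOn_invFun := by
    have h1 : ContinuousOn (localSection e) e.baseSet := he.contMDiffOn_localSection.continuousOn
    refine (isQuotientMap_mk (EQ := EQ) (G := G) (Q := Q)).continuous.comp_continuousOn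
      (f := fun p : MulAction.orbitRel.Quotient G Q × G => (localSection e p.1, p.2)) ?_
    refine ContinuousOn.prodMk ?_ continuousOn_snd
    exact h1.comp
      (s := e.baseSet ×ˢ (univ : Set G)) continuousOn_fst (fun _ h => h.1)

lemma localTriv_apply (he : IsPrincipalTrivialization EG EQ EB e) (v : ConjugateBundle EQ G Q) :
    localTriv e he v = (proj v, coord e v) := rfl

lemma localTriv_symm_apply (he : IsPrincipalTrivialization EG EQ EB e)
    (p : MulAction.orbitRel.Quotient G Q × G) :
    (localTriv e he).symm p = mk EQ (localSection e p.1) p.2 := rfl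

lemma localTriv_source (he : IsPrincipalTrivialization EG EQ EB e) :
    (localTriv e he).source = (proj : ConjugateBundle EQ G Q → _) ⁻¹' e.baseSet := rfl

lemma localTriv_target (he : IsPrincipalTrivialization EG EQ EB e) :
    (localTriv e he).target = e.baseSet ×ˢ univ := rfl

lemma contMDiffOn_localTriv_trans (he : IsPrincipalTrivialization EG EQ EB e)
    (he' : IsPrincipalTrivialization EG EQ EB e') :
    ContMDiffOn (𝓘(ℝ, EB).prod 𝓘(ℝ, EG)) (𝓘(ℝ, EB).prod 𝓘(ℝ, EG)) ∞
      (fun p => localTriv e' he' ((localTriv e he).symm p))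
      ((e.baseSet ∩ e'.baseSet) ×ˢ univ) := by
  have h : ContMDiffOn (𝓘(ℝ, EB).prod 𝓘(ℝ, EG)) 𝓘(ℝ, EG) ∞
      (fun p : MulAction.orbitRel.Quotient G Q × G => transition e e' p.1)
      ((e.baseSet ∩ e'.baseSet) ×ˢ univ) :=
    (he.contMDiffOn_transition he').comp contMDiffOn_fst (fun _ hp => hp.1)
  refine ContMDiffOn.congr (contMDiffOn_fst.prodMk ((h.inv.mul contMDiffOn_snd).mul h)) ?_
  rintro p ⟨hp, -⟩
  rw [localTriv_symm_apply, localTriv_apply, proj_mk, orbitMap_localSection hp.1]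
  refine Prod.ext rfl ?_
  exact coord_mk he' (by rw [e'.mem_source, orbitMap_localSection hp.1]; exact hp.2) p.2

variable [IsPrincipalBundle EG EQ EB G Q]

/-- The charts of `G̃` are the local trivializations `G̃|_U ≃ U × G` induced by the trivializations
of the principal bundle `π`, followed by the charts of `Q/G × G`. -/
noncomputable instance : ChartedSpace (ModelProd EB EG) (ConjugateBundle EQ G Q) where
  atlas := {c | ∃ (e : Trivialization G (orbitMap G Q)) (he : IsPrincipalTrivialization EG EQ EB e),
    ∃ c' ∈ atlas (ModelProd EB EG) (MulAction.orbitRel.Quotient G Q × G),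
      c = (localTriv e he).trans c'}
  chartAt v := (localTriv _ (isPrincipal_trivAt (EG := EG) (EQ := EQ) (EB := EB) (proj v))).trans
    (chartAt (ModelProd EB EG) (proj v, coord (trivAt EG EQ EB (proj v)) v))
  mem_chart_source v := ⟨mem_trivAt (EG := EG) (EQ := EQ) (EB := EB) (proj v),
    mem_chart_source (ModelProd EB EG) (proj v, coord (trivAt EG EQ EB (proj v)) v)⟩
  chart_mem_atlas _ := ⟨_, _, _, chart_mem_atlas _ _, rfl⟩

variable [IsManifold 𝓘(ℝ, EB) ∞ (MulAction.orbitRel.Quotient G Q)]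

instance : IsManifold (𝓘(ℝ, EB).prod 𝓘(ℝ, EG)) ∞ (ConjugateBundle EQ G Q) := by
  refine isManifold_of_contDiffOn _ _ _ ?_
  rintro _ _ ⟨e, he, c, hc, rfl⟩ ⟨e', he', c', hc', rfl⟩
  have hmc := IsManifold.subset_maximalAtlas (I := 𝓘(ℝ, EB).prod 𝓘(ℝ, EG)) (n := ∞) hc
  have hmc' := IsManifold.subset_maximalAtlas (I := 𝓘(ℝ, EB).prod 𝓘(ℝ, EG)) (n := ∞) hc'
  have h1 := contMDiffOn_symm_of_mem_maximalAtlas hmc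
  have h2 := contMDiffOn_of_mem_maximalAtlas hmc'
  have h3 := contMDiffOn_localTriv_trans he he'
  rw [← contMDiffOn_iff_contDiffOn]
  refine (𝓘(ℝ, EB).prod 𝓘(ℝ, EG)).contMDiff.comp_contMDiffOn ?_
  refine ContMDiffOn.comp (g := fun x => c' (localTriv e' he' ((localTriv e he).symm (c.symm x))))
    (t := (((localTriv e he).trans c).symm.trans ((localTriv e' he').trans c')).source) ?_
    (((𝓘(ℝ, EB).prod 𝓘(ℝ, EG)).contMDiffOn_symm).mono inter_subset_right) inter_subset_left
  refine h2.comp (h3.comp (h1.mono ?_) ?_) ?_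
  · intro x hx
    simp only [mfld_simps] at hx
    exact hx.1.1
  · intro x hx
    simp only [mfld_simps] at hx
    have hx1 : (c.symm x).1 ∈ e.baseSet := hx.1.2.1
    have hx2 : proj ((localTriv e he).symm (c.symm x)) ∈ e'.baseSet := hx.2.1
    rw [localTriv_symm_apply, proj_mk, orbitMap_localSection hx1] at hx2
    exact ⟨⟨hx1, hx2⟩, mem_univ _⟩
  · intro x hx
    simp only [mfld_simps] at hx
    exact hx.2.2

lemma contMDiffOn_localTriv (he : IsPrincipalTrivialization EG EQ EB e) :
    ContMDiffOn (𝓘(ℝ, EB).prod 𝓘(ℝ, EG)) (𝓘(ℝ, EB).prod 𝓘(ℝ, EG)) ∞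
      (localTriv (EQ := EQ) e he) (localTriv (EQ := EQ) e he).source := by
  intro v hv
  refine ContMDiffAt.contMDiffWithinAt ?_
  set c' := chartAt (ModelProd EB EG) (localTriv e he v) with hc'
  have hc : (localTriv e he).trans c' ∈ IsManifold.maximalAtlas (𝓘(ℝ, EB).prod 𝓘(ℝ, EG)) ∞
      (ConjugateBundle EQ G Q) :=
    IsManifold.subset_maximalAtlas ⟨e, he, c', chart_mem_atlas _ _, rfl⟩
  have hm : v ∈ ((localTriv e he).trans c').source := ⟨hv, mem_chart_source (ModelProd EB EG) (localTriv e he v)⟩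
  have h1 := contMDiffOn_of_mem_maximalAtlas hc
  have h2 := contMDiffOn_chart_symm (I := 𝓘(ℝ, EB).prod 𝓘(ℝ, EG)) (n := ∞)
    (x := localTriv e he v)
  have h3 := h2.comp h1 (fun x hx => c'.map_source hx.2)
  refine ((h3.congr fun x hx => ?_) v hm).contMDiffAt
    (((localTriv e he).trans c').open_source.mem_nhds hm)
  exact (c'.left_inv hx.2).symm

lemma contMDiff_proj : ContMDiff (𝓘(ℝ, EB).prod 𝓘(ℝ, EG)) 𝓘(ℝ, EB) ∞
    (proj : ConjugateBundle EQ G Q → _) := by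
  intro v
  have h := contMDiffOn_localTriv (isPrincipal_trivAt (EG := EG) (EQ := EQ) (EB := EB) (proj v))
  have hv : v ∈ (localTriv _ (isPrincipal_trivAt (EG := EG) (EQ := EQ) (EB := EB)
    (proj v))).source := mem_trivAt (EG := EG) (EQ := EQ) (EB := EB) (proj v)
  exact contMDiff_fst.contMDiffAt.comp v (h.contMDiffAt
    ((localTriv _ (isPrincipal_trivAt (EG := EG) (EQ := EQ) (EB := EB)
      (proj v))).open_source.mem_nhds hv))

end ConjugateBundle

/-! ### Affine discrete connections and the map `Υ` -/

/-- An affine discrete connection on `π : Q → Q/G`, with its level `γ : Q → G`. -/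
structure AffineDiscreteConnection (EG EQ : Type*) [NormedAddCommGroup EG] [NormedSpace ℝ EG]
    [NormedAddCommGroup EQ] [NormedSpace ℝ EQ]
    (G Q : Type*) [TopologicalSpace G] [ChartedSpace EG G] [Group G]
    [TopologicalSpace Q] [ChartedSpace EQ Q] [MulAction G Q] where
  level : Q → G
  contMDiff_level : ContMDiff 𝓘(ℝ, EQ) 𝓘(ℝ, EG) ∞ level
  level_smul : ∀ (g : G) (q : Q), level (g • q) = g * level q * g⁻¹
  toFun : Q × Q → G
  contMDiff_toFun : ContMDiff (𝓘(ℝ, EQ).prod 𝓘(ℝ, EQ)) 𝓘(ℝ, EG) ∞ toFun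
  map_smul_smul : ∀ (g₀ g₁ : G) (q₀ q₁ : Q), toFun (g₀ • q₀, g₁ • q₁) = g₁ * toFun (q₀, q₁) * g₀⁻¹
  map_level : ∀ q : Q, toFun (q, level q • q) = 1

namespace AffineDiscreteConnection

variable (A : AffineDiscreteConnection EG EQ G Q)

/-- The map `Υ : Q × Q → G̃ × Q/G`, `Υ(q₀, q₁) = (ρ(q₀, 𝒜_d(q₀, q₁)), π(q₁))`. -/
def upsilon (q : Q × Q) : ConjugateBundle EQ G Q × MulAction.orbitRel.Quotient G Q :=
  (ConjugateBundle.mk EQ q.1 (A.toFun q), orbitMap G Q q.2)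

lemma upsilon_eq_iff {q q' : Q × Q} : A.upsilon q = A.upsilon q' ↔ ∃ g : G, g • q' = q := by
  constructor
  · intro h
    obtain ⟨g, h1, h2⟩ := ConjugateBundle.mk_eq_iff.1 (congrArg Prod.fst h)
    obtain ⟨k, h3⟩ := orbitMap_eq_iff.1 (congrArg Prod.snd h)
    have h4 : A.toFun q = k * A.toFun q' * g⁻¹ := by
      rw [← A.map_smul_smul, h1, h3]
    rw [h4, mul_left_inj, mul_left_inj] at h2
    subst h2
    exact ⟨g, Prod.ext h1 h3⟩
  · rintro ⟨g, rfl⟩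
    exact Prod.ext (ConjugateBundle.mk_eq_iff.2 ⟨g, rfl, (A.map_smul_smul g g q'.1 q'.2).symm⟩)
      (orbitMap_smul g q'.2)

lemma upsilon_surjective : Function.Surjective A.upsilon := by
  rintro ⟨v, b⟩
  obtain ⟨q₀, w, rfl⟩ := ConjugateBundle.exists_rep v
  obtain ⟨q₁, rfl⟩ := exists_orbitMap_eq b
  refine ⟨(q₀, (w * (A.toFun (q₀, q₁))⁻¹) • q₁), ?_⟩
  have h := A.map_smul_smul 1 (w * (A.toFun (q₀, q₁))⁻¹) q₀ q₁
  rw [one_smul, inv_one, mul_one, inv_mul_cancel_right] at h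
  exact Prod.ext (congrArg (ConjugateBundle.mk EQ q₀) h) (orbitMap_smul _ _)

lemma eq_one_of_smul_eq (A : AffineDiscreteConnection EG EQ G Q) {g : G} {q : Q × Q} (h : g • q = q) : g = 1 := by
  have h1 := A.map_smul_smul 1 g q.1 q.2
  have h2 : g • q.2 = q.2 := congrArg Prod.snd h
  rw [one_smul, h2, inv_one, mul_one] at h1
  exact (right_eq_mul.1 h1)

end AffineDiscreteConnection

/-! ### The adjoint bundle of `Q × Q → (Q × Q)/G` and its pullback `ĝ` to `G̃ × Q/G` -/

variable [LieGroup 𝓘(ℝ, EG) ∞ G]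

variable (EG) in
/-- The orbit relation of the action `g • (m, ξ) = (g • m, Ad g ξ)` of `G` on `M × 𝔤`. -/
def adjointSetoid (G M : Type*) [TopologicalSpace G] [ChartedSpace EG G] [Group G]
    [LieGroup 𝓘(ℝ, EG) ∞ G] [MulAction G M] : Setoid (M × GroupLieAlgebra 𝓘(ℝ, EG) G) where
  r a b := ∃ g : G, g • b.1 = a.1 ∧ Ad g b.2 = a.2
  iseqv :=
    { refl := fun a => ⟨1, by simp, by rw [Ad_one]; rfl⟩
      symm := by
        rintro a b ⟨g, h1, h2⟩
        exact ⟨g⁻¹, by rw [← h1, inv_smul_smul], by rw [← h2, Ad_inv_Ad]⟩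
      trans := by
        rintro a b c ⟨g, h1, h2⟩ ⟨k, h3, h4⟩
        exact ⟨g * k, by rw [mul_smul, h3, h1], by rw [← h2, ← h4, Ad_mul]; rfl⟩ }

variable (EG) in
/-- The adjoint bundle `(M × 𝔤)/G`. -/
def AdjointBundle (G M : Type*) [TopologicalSpace G] [ChartedSpace EG G] [Group G]
    [LieGroup 𝓘(ℝ, EG) ∞ G] [MulAction G M] : Type _ :=
  Quotient (adjointSetoid EG G M)

/-- The class `[m, ξ]` in the adjoint bundle. -/
def AdjointBundle.mk {M : Type*} [MulAction G M] (m : M) (ξ : GroupLieAlgebra 𝓘(ℝ, EG) G) :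
    AdjointBundle EG G M :=
  Quotient.mk (adjointSetoid EG G M) (m, ξ)

lemma AdjointBundle.mk_eq_iff {M : Type*} [MulAction G M] {m m' : M}
    {ξ ξ' : GroupLieAlgebra 𝓘(ℝ, EG) G} :
    AdjointBundle.mk m ξ = AdjointBundle.mk m' ξ' ↔ ∃ g : G, g • m' = m ∧ Ad g ξ' = ξ :=
  Quotient.eq (r := adjointSetoid EG G M)

/-- The projection `[(q₀, q₁), ξ] ↦ Υ(q₀, q₁)` of the adjoint bundle of `Q × Q` to `G̃ × Q/G`. -/
def AdjointBundle.base (A : AffineDiscreteConnection EG EQ G Q) (z : AdjointBundle EG G (Q × Q)) :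
    ConjugateBundle EQ G Q × MulAction.orbitRel.Quotient G Q :=
  Quotient.lift (s := adjointSetoid EG G (Q × Q)) (fun a => A.upsilon a.1)
    (fun _ _ h => A.upsilon_eq_iff.2 (h.imp fun _ hg => hg.1)) z

/-- The fibre `ĝ_y = {[(q₀, q₁), ξ] | Υ(q₀, q₁) = y}` at `y ∈ G̃ × Q/G` of the pullback `ĝ` of the
adjoint bundle of `Q × Q`. The model space `EB` of `Q/G` is a parameter only so that instance search
can find the smooth structure. -/
def HatG (_EB : Type*) (A : AffineDiscreteConnection EG EQ G Q)
    (y : ConjugateBundle EQ G Q × MulAction.orbitRel.Quotient G Q) : Type _ :=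
  {z : AdjointBundle EG G (Q × Q) // z.base A = y}

namespace HatG

variable {A : AffineDiscreteConnection EG EQ G Q}
  {y : ConjugateBundle EQ G Q × MulAction.orbitRel.Quotient G Q}

/-- The element `[(q₀, q₁), ξ]` of the fibre of `ĝ` at `Υ(q₀, q₁)`. -/
def mk (EB : Type*) (A : AffineDiscreteConnection EG EQ G Q) (q : Q × Q)
    (ξ : GroupLieAlgebra 𝓘(ℝ, EG) G) : HatG EB A (A.upsilon q) :=
  ⟨AdjointBundle.mk q ξ, rfl⟩

/-- For `q` over `y`, the bijection `ξ ↦ [q, ξ]` of `𝔤` with the fibre at `y`. -/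
noncomputable def fibreEquiv (EB : Type*) (A : AffineDiscreteConnection EG EQ G Q) (q : Q × Q)
    (h : A.upsilon q = y) : GroupLieAlgebra 𝓘(ℝ, EG) G ≃ HatG EB A y :=
  Equiv.ofBijective (fun ξ => ⟨AdjointBundle.mk q ξ, h⟩) <| by
    constructor
    · intro ξ ξ' hξ
      obtain ⟨g, h1, h2⟩ := AdjointBundle.mk_eq_iff.1 (congrArg Subtype.val hξ)
      rw [A.eq_one_of_smul_eq h1, Ad_one] at h2
      exact h2.symm
    · rintro ⟨z, hz⟩
      obtain ⟨⟨q', ξ⟩, rfl⟩ := Quotient.exists_rep z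
      obtain ⟨g, hg⟩ := A.upsilon_eq_iff.1 (h.trans hz.symm)
      exact ⟨Ad g ξ, Subtype.ext (AdjointBundle.mk_eq_iff.2 ⟨g, hg, rfl⟩)⟩

/-- A chosen point of `Q × Q` over `y`. -/
noncomputable def rep (A : AffineDiscreteConnection EG EQ G Q)
    (y : ConjugateBundle EQ G Q × MulAction.orbitRel.Quotient G Q) : Q × Q :=
  (A.upsilon_surjective y).choose

lemma upsilon_rep : A.upsilon (rep A y) = y := (A.upsilon_surjective y).choose_spec

/-- The identification of the fibre with `𝔤` by means of the chosen point over `y`; the induced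
vector space structure and topology do not depend on the choice. -/
noncomputable def repEquiv (EB : Type*) (A : AffineDiscreteConnection EG EQ G Q)
    (y : ConjugateBundle EQ G Q × MulAction.orbitRel.Quotient G Q) :
    HatG EB A y ≃ GroupLieAlgebra 𝓘(ℝ, EG) G :=
  (fibreEquiv EB A (rep A y) upsilon_rep).symm

noncomputable instance : AddCommGroup (HatG EB A y) := (repEquiv EB A y).addCommGroup

noncomputable instance : Module ℝ (HatG EB A y) := (repEquiv EB A y).module ℝ

noncomputable instance : TopologicalSpace (HatG EB A y) :=
  TopologicalSpace.induced (repEquiv EB A y) inferInstance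

lemma repEquiv_symm_val (ξ : GroupLieAlgebra 𝓘(ℝ, EG) G) :
    ((repEquiv EB A y).symm ξ).1 = AdjointBundle.mk (rep A y) ξ := rfl

lemma repEquiv_mk {g : G} {q : Q × Q} (hg : g • q = rep A (A.upsilon q))
    (ξ : GroupLieAlgebra 𝓘(ℝ, EG) G) : repEquiv EB A (A.upsilon q) (mk EB A q ξ) = Ad g ξ := by
  rw [← Equiv.eq_symm_apply]
  refine Subtype.ext ?_
  rw [repEquiv_symm_val]
  refine AdjointBundle.mk_eq_iff.2 ⟨g⁻¹, ?_, Ad_inv_Ad g ξ⟩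
  rw [← hg, inv_smul_smul]

lemma exists_smul_eq_rep (q : Q × Q) : ∃ g : G, g • q = rep A (A.upsilon q) :=
  A.upsilon_eq_iff.1 upsilon_rep

lemma repEquiv_add (a b : HatG EB A y) :
    repEquiv EB A y (a + b) = repEquiv EB A y a + repEquiv EB A y b :=
  (repEquiv EB A y).apply_symm_apply _

lemma repEquiv_smul (c : ℝ) (a : HatG EB A y) :
    repEquiv EB A y (c • a) = c • repEquiv EB A y a :=
  (repEquiv EB A y).apply_symm_apply _

lemma mk_add (q : Q × Q) (ξ η : GroupLieAlgebra 𝓘(ℝ, EG) G) :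
    mk EB A q (ξ + η) = mk EB A q ξ + mk EB A q η := by
  obtain ⟨g, hg⟩ := exists_smul_eq_rep (A := A) q
  apply (repEquiv EB A _).injective
  rw [repEquiv_add, repEquiv_mk hg, repEquiv_mk hg, repEquiv_mk hg, map_add]

lemma mk_smul (q : Q × Q) (c : ℝ) (ξ : GroupLieAlgebra 𝓘(ℝ, EG) G) :
    mk EB A q (c • ξ) = c • mk EB A q ξ := by
  obtain ⟨g, hg⟩ := exists_smul_eq_rep (A := A) q
  apply (repEquiv EB A _).injective
  rw [repEquiv_smul, repEquiv_mk hg, repEquiv_mk hg, map_smul]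

section Trivialization

variable {e e' : Trivialization G (orbitMap G Q)}

open IsPrincipalTrivialization

/-- The fibre coordinate of the local trivialization of `ĝ` induced by a trivialization `e` of `π`;
by `coord_mk` it is `[(q₀, q₁), ξ] ↦ Ad k⁻¹ ξ` with `e q₀ = (π(q₀), k)`. -/
noncomputable def coord (e : Trivialization G (orbitMap G Q)) (z : HatG EB A y) : EG :=
  Ad (e (rep A y).1).2⁻¹ (repEquiv EB A y z)

lemma coord_mk (he : IsPrincipalTrivialization EG EQ EB e) {q : Q × Q} (hq : q.1 ∈ e.source)
    (ξ : GroupLieAlgebra 𝓘(ℝ, EG) G) : coord e (mk EB A q ξ) = Ad (e q.1).2⁻¹ ξ := by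
  obtain ⟨g, hg⟩ := exists_smul_eq_rep (A := A) q
  have h : (rep A (A.upsilon q)).1 = g • q.1 := congrArg Prod.fst hg.symm
  unfold coord
  rw [repEquiv_mk hg, h, he.equivariant g q.1 hq, mul_inv_rev, Ad_mul]
  exact congrArg (Ad _) (Ad_inv_Ad g ξ)

lemma rep_fst_mem (hy : y.1.proj ∈ e.baseSet) : (rep A y).1 ∈ e.source := by
  rw [e.mem_source]
  have h : orbitMap G Q (rep A y).1 = y.1.proj :=
    congrArg (fun x => x.1.proj) (upsilon_rep (A := A) (y := y))
  rwa [h]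

/-- The part of `G̃ × Q/G` lying over the base set of `e`. -/
def baseOf (EQ : Type*) (e : Trivialization G (orbitMap G Q)) :
    Set (ConjugateBundle EQ G Q × MulAction.orbitRel.Quotient G Q) :=
  {y | y.1.proj ∈ e.baseSet}

lemma isOpen_baseOf : IsOpen (baseOf EQ e) :=
  e.open_baseSet.preimage (ConjugateBundle.continuous_proj.comp continuous_fst)

/-- The local trivialization of `ĝ` induced by a trivialization of `π`. -/
noncomputable def pretriv (EB : Type*) (A : AffineDiscreteConnection EG EQ G Q)
    (e : Trivialization G (orbitMap G Q)) : Pretrivialization EG (π EG (HatG EB A)) where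
  toFun z := (z.1, coord e z.2)
  invFun p := ⟨p.1, (repEquiv EB A p.1).symm (Ad (e (rep A p.1).1).2 p.2)⟩
  source := π EG (HatG EB A) ⁻¹' (baseOf EQ e)
  target := baseOf EQ e ×ˢ univ
  map_source' _ hz := ⟨hz, mem_univ _⟩
  map_target' _ hp := hp.1
  left_inv' z _ := by
    refine congrArg (TotalSpace.mk z.1) ?_
    rw [Equiv.symm_apply_eq]
    exact Ad_Ad_inv _ _
  right_inv' p _ := by
    refine Prod.ext rfl ?_
    unfold coord
    rw [Equiv.apply_symm_apply]
    exact Ad_inv_Ad _ _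
  open_target := isOpen_baseOf.prod isOpen_univ
  baseSet := baseOf EQ e
  open_baseSet := isOpen_baseOf
  source_eq := rfl
  target_eq := rfl
  proj_toFun _ _ := rfl

/-- The coordinate changes of `ĝ`. -/
noncomputable def coordChange (e e' : Trivialization G (orbitMap G Q))
    (y : ConjugateBundle EQ G Q × MulAction.orbitRel.Quotient G Q) : EG →L[ℝ] EG :=
  AdModel (transition e e' y.1.proj)⁻¹

lemma coordChange_apply (he : IsPrincipalTrivialization EG EQ EB e)
    (he' : IsPrincipalTrivialization EG EQ EB e')
    (hy : y ∈ (pretriv EB A e).baseSet ∩ (pretriv EB A e').baseSet) (v : EG) :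
    coordChange e e' y v = (pretriv EB A e' ⟨y, (pretriv EB A e).symm y v⟩).2 := by
  rw [(pretriv EB A e).mk_symm hy.1]
  have h : orbitMap G Q (rep A y).1 = y.1.proj :=
    congrArg (fun x => x.1.proj) (upsilon_rep (A := A) (y := y))
  have h1 := he.snd_eq_mul_transition he' (rep_fst_mem (A := A) hy.1) (rep_fst_mem (A := A) hy.2)
  rw [h] at h1
  change _ = (Ad (e' (rep A y).1).2⁻¹
    (repEquiv EB A y ((repEquiv EB A y).symm (Ad (e (rep A y).1).2 v))) : EG)
  rw [Equiv.apply_symm_apply, h1, mul_inv_rev, Ad_mul]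
  exact (congrArg (Ad _) (Ad_inv_Ad _ _)).symm

variable [IsPrincipalBundle EG EQ EB G Q]
  [IsManifold 𝓘(ℝ, EB) ∞ (MulAction.orbitRel.Quotient G Q)]

lemma contMDiffOn_coordChange (he : IsPrincipalTrivialization EG EQ EB e)
    (he' : IsPrincipalTrivialization EG EQ EB e') :
    ContMDiffOn ((𝓘(ℝ, EB).prod 𝓘(ℝ, EG)).prod 𝓘(ℝ, EB)) 𝓘(ℝ, EG →L[ℝ] EG) ∞
      (coordChange (EG := EG) (EQ := EQ) e e')
      ((pretriv EB A e).baseSet ∩ (pretriv EB A e').baseSet) := by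
  refine (contMDiff_AdModel (EG := EG) (G := G)).comp_contMDiffOn (ContMDiffOn.inv ?_)
  exact (he.contMDiffOn_transition he').comp
    (ConjugateBundle.contMDiff_proj.comp contMDiff_fst).contMDiffOn (fun _ hy => hy)

/-- The vector bundle structure of `ĝ`: its trivializations are those induced by the trivializations
of `π`. -/
noncomputable def prebundle (EB : Type*) [NormedAddCommGroup EB] [NormedSpace ℝ EB]
    [ChartedSpace EB (MulAction.orbitRel.Quotient G Q)]
    [IsPrincipalBundle EG EQ EB G Q] [IsManifold 𝓘(ℝ, EB) ∞ (MulAction.orbitRel.Quotient G Q)]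
    (A : AffineDiscreteConnection EG EQ G Q) : VectorPrebundle ℝ EG (HatG EB A) where
  pretrivializationAtlas := {t | ∃ e : Trivialization G (orbitMap G Q),
    IsPrincipalTrivialization EG EQ EB e ∧ t = pretriv EB A e}
  pretrivialization_linear' := by
    rintro _ ⟨e, -, rfl⟩
    refine ⟨fun y _ => ⟨fun a b => ?_, fun c a => ?_⟩⟩
    · change (Ad (e (rep A y).1).2⁻¹ (repEquiv EB A y (a + b)) : EG) = _
      rw [repEquiv_add, map_add]
      rfl
    · change (Ad (e (rep A y).1).2⁻¹ (repEquiv EB A y (c • a)) : EG) = _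
      rw [repEquiv_smul, map_smul]
      rfl
  pretrivializationAt y := pretriv EB A (trivAt EG EQ EB y.1.proj)
  mem_base_pretrivializationAt y := mem_trivAt (EG := EG) (EQ := EQ) (EB := EB) y.1.proj
  pretrivialization_mem_atlas y := ⟨_, isPrincipal_trivAt y.1.proj, rfl⟩
  exists_coordChange := by
    rintro _ ⟨e, he, rfl⟩ _ ⟨e', he', rfl⟩
    exact ⟨coordChange e e', (contMDiffOn_coordChange he he').continuousOn,
      fun y hy v => coordChange_apply he he' hy v⟩
  totalSpaceMk_isInducing y := by
    have h1 : IsInducing (repEquiv EB A y) := ⟨rfl⟩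
    let k : G := (trivAt EG EQ EB y.1.proj (rep A y).1).2⁻¹
    let H : GroupLieAlgebra 𝓘(ℝ, EG) G ≃ₜ GroupLieAlgebra 𝓘(ℝ, EG) G :=
      { toFun := Ad k
        invFun := Ad k⁻¹
        left_inv := Ad_inv_Ad k
        right_inv := Ad_Ad_inv k
        continuous_toFun := (Ad k).continuous
        continuous_invFun := (Ad k⁻¹).continuous }
    have h2 : IsInducing (fun v : EG => (y, v)) := isInducing_const_prod.2 IsInducing.id
    exact h2.comp (H.isInducing.comp h1)

instance : (prebundle EB A).IsContMDiff ((𝓘(ℝ, EB).prod 𝓘(ℝ, EG)).prod 𝓘(ℝ, EB)) ∞ where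
  exists_contMDiffCoordChange := by
    rintro _ ⟨e, he, rfl⟩ _ ⟨e', he', rfl⟩
    exact ⟨coordChange e e', contMDiffOn_coordChange he he',
      fun y hy v => coordChange_apply he he' hy v⟩

noncomputable instance : TopologicalSpace (TotalSpace EG (HatG EB A)) :=
  (prebundle EB A).totalSpaceTopology

noncomputable instance : FiberBundle EG (HatG EB A) := (prebundle EB A).toFiberBundle

instance : VectorBundle ℝ EG (HatG EB A) := (prebundle EB A).toVectorBundle

instance : ContMDiffVectorBundle ∞ EG (HatG EB A)
    ((𝓘(ℝ, EB).prod 𝓘(ℝ, EG)).prod 𝓘(ℝ, EB)) :=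
  (prebundle EB A).contMDiffVectorBundle _

end Trivialization

end HatG

/-- The section space `Γ(G̃ × Q/G, T*(G̃ × Q/G) ⊕ ĝ*)` of smooth sections. -/
abbrev ReducedSection (EB : Type*) [NormedAddCommGroup EB] [NormedSpace ℝ EB]
    [ChartedSpace EB (MulAction.orbitRel.Quotient G Q)]
    [IsPrincipalBundle EG EQ EB G Q] [IsManifold 𝓘(ℝ, EB) ∞ (MulAction.orbitRel.Quotient G Q)]
    (A : AffineDiscreteConnection EG EQ G Q) : Type _ :=
  Cₛ^∞⟮(𝓘(ℝ, EB).prod 𝓘(ℝ, EG)).prod 𝓘(ℝ, EB);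
    (((EB × EG) × EB) →L[ℝ] ℝ) × (EG →L[ℝ] ℝ),
    (fun y : ConjugateBundle EQ G Q × MulAction.orbitRel.Quotient G Q =>
      TangentSpace ((𝓘(ℝ, EB).prod 𝓘(ℝ, EG)).prod 𝓘(ℝ, EB)) y →L[ℝ] Bundle.Trivial _ ℝ y) ×ᵇ
    (fun y : ConjugateBundle EQ G Q × MulAction.orbitRel.Quotient G Q =>
      HatG EB A y →L[ℝ] Bundle.Trivial _ ℝ y)⟯

/-- The pairing of `α = α₁ ⊕ α₂ ∈ T*_y(G̃ × Q/G) ⊕ ĝ*_y` with `u ⊕ η ∈ T_y(G̃ × Q/G) ⊕ ĝ_y`. -/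
noncomputable def ReducedSection.pairing {EB : Type*} [NormedAddCommGroup EB] [NormedSpace ℝ EB]
    [ChartedSpace EB (MulAction.orbitRel.Quotient G Q)]
    [IsPrincipalBundle EG EQ EB G Q] [IsManifold 𝓘(ℝ, EB) ∞ (MulAction.orbitRel.Quotient G Q)]
    {A : AffineDiscreteConnection EG EQ G Q} (f : ReducedSection EB A)
    (y : ConjugateBundle EQ G Q × MulAction.orbitRel.Quotient G Q)
    (u : TangentSpace ((𝓘(ℝ, EB).prod 𝓘(ℝ, EG)).prod 𝓘(ℝ, EB)) y) (η : HatG EB A y) : ℝ :=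
  (f y).1 u + (f y).2 η

/-- The tangent map `TΥ` at `(q₀, q₁)`. -/
noncomputable def AffineDiscreteConnection.tangentUpsilon
    (EB : Type*) [NormedAddCommGroup EB] [NormedSpace ℝ EB]
    [ChartedSpace EB (MulAction.orbitRel.Quotient G Q)] [IsPrincipalBundle EG EQ EB G Q]
    (A : AffineDiscreteConnection EG EQ G Q) (q : Q × Q) :
    TangentSpace (𝓘(ℝ, EQ).prod 𝓘(ℝ, EQ)) q →L[ℝ]
      TangentSpace ((𝓘(ℝ, EB).prod 𝓘(ℝ, EG)).prod 𝓘(ℝ, EB)) (A.upsilon q) :=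
  mfderiv (𝓘(ℝ, EQ).prod 𝓘(ℝ, EQ)) ((𝓘(ℝ, EB).prod 𝓘(ℝ, EG)).prod 𝓘(ℝ, EB)) A.upsilon q

end Principal

end DiscreteReduction

open DiscreteReduction

/-!
A `G`-equivariant `1`-form `f` on `Q × Q` descends to `G̃ × Q/G` because the map `TΥ ⊕ 𝔄`
identifies each tangent space `T_q(Q × Q)` with the fibre of `T(G̃ × Q/G) ⊕ ĝ` over `Υ(q)`,
compatibly with the action.

The identification (`existsUnique_dUpsilon_eq`) rests on the fact that `Υ` is itself a principal
bundle. Two trivializations of `π : Q → Q/G` give a local section `σ` of `Υ` (`localLift`), and the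
`G`-component `θ` of the first trivialization satisfies `q = θ(q) • σ(Υ(q))`. Differentiating this
identity shows that `TΥ` is surjective and that its kernel consists of infinitesimal generators
(`exists_rightInverse_dUpsilon`), on which the connection `𝔄` is inverse to `ξ ↦ ξ_{Q × Q}`. No
dimension count is needed.

The reduced section is then defined over `y` by means of one chosen point in the fibre `Υ⁻¹(y)`: its
component in `T*(G̃ × Q/G)` is `f` on horizontal lifts, its component in `ĝ*` is `f` on
infinitesimal generators. Equivariance of `f` and of `𝔄`, together with `Υ ∘ l_g = Υ`, shows that
the defining formula holds at every point over `y` (`reducedHorizontal_add_reducedVertical`).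
Smoothness is local and can now be read off along `σ`, where the chosen point does not enter: the
component in `ĝ*` is `ξ ↦ f(σ(y))(ξ_{Q × Q})`, and the component in `T*(G̃ × Q/G)` is
`u ↦ f(σ(y))(Tσ u) - f(σ(y))(𝔄(Tσ u)_{Q × Q})`. Uniqueness holds since `Υ` is onto and the
identification of the fibres is onto.
-/

namespace DiscreteReduction

/-! ### Smooth sections of dual bundles and of direct sums -/

section Sections

variable {EB HB B : Type*} [NormedAddCommGroup EB] [NormedSpace ℝ EB] [TopologicalSpace HB]
  {IB : ModelWithCorners ℝ EB HB} [TopologicalSpace B] [ChartedSpace HB B] {n : WithTop ℕ∞}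
  {F F' : Type*} [NormedAddCommGroup F] [NormedSpace ℝ F] [NormedAddCommGroup F']
  [NormedSpace ℝ F']

/-- A family of continuous linear functionals on a finite-dimensional space is smooth as soon as it
is smooth on each fixed vector. -/
lemma contMDiffAt_clm_of_apply [FiniteDimensional ℝ F] {L : B → F →L[ℝ] ℝ} {x₀ : B}
    (h : ∀ w, ContMDiffAt IB 𝓘(ℝ, ℝ) n (fun x => L x w) x₀) :
    ContMDiffAt IB 𝓘(ℝ, F →L[ℝ] ℝ) n L x₀ := by
  let b := Module.finBasis ℝ F
  have e : L = fun x => ∑ i, L x (b i) • (LinearMap.toContinuousLinearMap (b.coord i)) := by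
    funext x
    refine ContinuousLinearMap.coe_injective (b.ext fun j => ?_)
    simp [Finsupp.single_apply]
  rw [e]
  exact ContMDiffAt.sum fun i _ => (h (b i)).smul contMDiffAt_const

variable {E E' : B → Type*} [∀ x, AddCommGroup (E x)] [∀ x, Module ℝ (E x)]
  [∀ x, TopologicalSpace (E x)] [TopologicalSpace (TotalSpace F E)]
  [FiberBundle F E] [VectorBundle ℝ F E]
  [∀ x, AddCommGroup (E' x)] [∀ x, Module ℝ (E' x)]
  [∀ x, TopologicalSpace (E' x)] [TopologicalSpace (TotalSpace F' E')]
  [FiberBundle F' E'] [VectorBundle ℝ F' E']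

/-- A section of the dual of a vector bundle of finite rank is smooth at a point if it is smooth on
the local frames of the bundle that are constant in the preferred trivialization. -/
lemma contMDiffAt_dual_section [FiniteDimensional ℝ F]
    {s : ∀ x, E x →L[ℝ] Bundle.Trivial B ℝ x} {x₀ : B}
    (h : ∀ w : F, ContMDiffAt IB 𝓘(ℝ, ℝ) n
      (fun x => (s x ((trivializationAt F E x₀).symm x w) : ℝ)) x₀) :
    ContMDiffAt IB (IB.prod 𝓘(ℝ, F →L[ℝ] ℝ)) n
      (fun x => TotalSpace.mk' (F →L[ℝ] ℝ) (E := fun x => E x →L[ℝ] Bundle.Trivial B ℝ x) x (s x))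
      x₀ := by
  rw [contMDiffAt_hom_bundle]
  refine ⟨contMDiffAt_id, contMDiffAt_clm_of_apply fun w => ?_⟩
  refine (h w).congr_of_eventuallyEq ?_
  filter_upwards [(trivializationAt F E x₀).open_baseSet.mem_nhds
    (mem_baseSet_trivializationAt F E x₀)] with x hx
  simp [ContinuousLinearMap.inCoordinates, Trivialization.symmL_apply _ hx]

/-- A section of a direct sum is smooth at a point if its components are. -/
lemma contMDiffAt_prod_section {s : ∀ x, E x} {s' : ∀ x, E' x} {x₀ : B}
    (h : ContMDiffAt IB (IB.prod 𝓘(ℝ, F)) n (fun x => TotalSpace.mk' F x (s x)) x₀)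
    (h' : ContMDiffAt IB (IB.prod 𝓘(ℝ, F')) n (fun x => TotalSpace.mk' F' x (s' x)) x₀) :
    ContMDiffAt IB (IB.prod 𝓘(ℝ, F × F')) n
      (fun x => TotalSpace.mk' (F × F') (E := E ×ᵇ E') x (s x, s' x)) x₀ := by
  rw [contMDiffAt_section] at h h' ⊢
  exact h.prodMk_space h'

/-- Smooth maps into the total space of a trivial bundle have smooth fibre components. -/
lemma contMDiffAt_of_trivial_section {EM HM M : Type*} [NormedAddCommGroup EM] [NormedSpace ℝ EM]
    [TopologicalSpace HM] {IM : ModelWithCorners ℝ EM HM} [TopologicalSpace M] [ChartedSpace HM M]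
    {b : M → B} {s : M → F} {x₀ : M}
    (h : ContMDiffAt IM (IB.prod 𝓘(ℝ, F)) n
      (fun x => TotalSpace.mk' F (E := Bundle.Trivial B F) (b x) (s x)) x₀) :
    ContMDiffAt IM 𝓘(ℝ, F) n s x₀ :=
  (contMDiffAt_totalSpace.1 h).2

end Sections

/-! ### Infinitesimal generators of a smooth action -/

section Generators

variable {EG : Type*} [NormedAddCommGroup EG] [NormedSpace ℝ EG]
  {G : Type*} [TopologicalSpace G] [ChartedSpace EG G] [Group G]
  {E : Type*} [NormedAddCommGroup E] [NormedSpace ℝ E] {H : Type*} [TopologicalSpace H]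
  (I : ModelWithCorners ℝ E H) {M : Type*} [TopologicalSpace M] [ChartedSpace H M] [MulAction G M]

variable (EG G) in
/-- The linear map `ξ ↦ ξ_M(x)` from the Lie algebra to the tangent space at `x`, in terms of the
model spaces. -/
noncomputable def infGeneratorL (x : M) : EG →L[ℝ] E :=
  mfderiv 𝓘(ℝ, EG) I (fun g : G => g • x) 1

variable {I}

lemma mdifferentiableAt_orbit
    (hs : ContMDiff (𝓘(ℝ, EG).prod I) I ∞ (fun p : G × M => p.1 • p.2)) (x : M) (g : G) :
    MDifferentiableAt 𝓘(ℝ, EG) I (fun g : G => g • x) g :=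
  (hs.comp (contMDiff_id.prodMk contMDiff_const)).mdifferentiable (by simp) g

lemma mdifferentiableAt_smul
    (hs : ContMDiff (𝓘(ℝ, EG).prod I) I ∞ (fun p : G × M => p.1 • p.2)) (g : G) (x : M) :
    MDifferentiableAt I I (fun x : M => g • x) x :=
  (hs.comp (contMDiff_const.prodMk contMDiff_id)).mdifferentiable (by simp) x

/-- Every velocity of an orbit map is the value of an infinitesimal generator: writing
`k • x = (k g⁻¹) • (g • x)` moves the base point of the derivative from `g` to `1`. -/
lemma mfderiv_orbit_eq_infGenerator [LieGroup 𝓘(ℝ, EG) ∞ G]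
    (hs : ContMDiff (𝓘(ℝ, EG).prod I) I ∞ (fun p : G × M => p.1 • p.2)) (x : M) (g : G) (v : EG) :
    (mfderiv 𝓘(ℝ, EG) I (fun k : G => k • x) g : EG →L[ℝ] E) v =
      infGeneratorL EG G I (g • x)
        ((mfderiv 𝓘(ℝ, EG) 𝓘(ℝ, EG) (fun k : G => k * g⁻¹) g : EG →L[ℝ] EG) v) := by
  have hc : (fun k : G => k • x) = (fun k : G => k • (g • x)) ∘ (fun k : G => k * g⁻¹) := by
    funext k; simp [smul_smul]
  have hr : MDifferentiableAt 𝓘(ℝ, EG) 𝓘(ℝ, EG) (fun k : G => k * g⁻¹) g :=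
    (contMDiff_id.mul contMDiff_const (I := 𝓘(ℝ, EG)) (n := ∞)).mdifferentiable (by simp) g
  have h := mfderiv_comp_of_eq (x := g) (y := (1 : G)) (mdifferentiableAt_orbit hs (g • x) 1) hr
    (by simp)
  rw [← hc] at h
  -- the chain rule produces the base point `g * g⁻¹` instead of `1`
  have e1 : ∀ k : G, k = 1 →
      (mfderiv 𝓘(ℝ, EG) I (fun k : G => k • (g • x)) k : EG →L[ℝ] E) =
        infGeneratorL EG G I (g • x) := by
    rintro _ rfl; rfl
  have e2 := congrArg (fun L : EG →L[ℝ] E => L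
    ((mfderiv 𝓘(ℝ, EG) 𝓘(ℝ, EG) (fun k : G => k * g⁻¹) g : EG →L[ℝ] EG) v))
    (e1 (g * g⁻¹) (mul_inv_cancel g))
  exact (congrArg (fun L : EG →L[ℝ] E => L v) h).trans e2

/-- The infinitesimal generator of `ξ` is a smooth vector field: it is the tangent map of the action
applied to the pair of `ξ ∈ T₁G` and the zero vector field. -/
lemma contMDiff_infGenerator [IsManifold 𝓘(ℝ, EG) ∞ G] [IsManifold I ∞ M]
    (hs : ContMDiff (𝓘(ℝ, EG).prod I) I ∞ (fun p : G × M => p.1 • p.2)) (ξ : EG) :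
    ContMDiff I (I.prod 𝓘(ℝ, E)) ∞
      (fun x : M => (⟨x, infGeneratorL EG G I x ξ⟩ : TangentBundle I M)) := by
  have : IsManifold 𝓘(ℝ, EG) 1 G := .of_le (n := ∞) (by simp)
  have : IsManifold I 1 M := .of_le (n := ∞) (by simp)
  have h1 : ContMDiff I (𝓘(ℝ, EG).prod 𝓘(ℝ, EG)) ∞
      (fun _ : M => (⟨1, ξ⟩ : TangentBundle 𝓘(ℝ, EG) G)) := contMDiff_const
  have h2 : ContMDiff I (I.prod 𝓘(ℝ, E)) ∞ (fun x : M => (⟨x, 0⟩ : TangentBundle I M)) :=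
    contMDiff_zeroSection _ _
  have h3 := (hs.contMDiff_tangentMap (m := ∞) (by simp)).comp
    ((contMDiff_equivTangentBundleProd_symm (I := 𝓘(ℝ, EG)) (I' := I) (M := G) (M' := M)
      (n := ∞)).comp (h1.prodMk h2))
  convert! h3 using 1
  funext x
  have e0 : ∀ (a : E) (L : E →L[ℝ] E), a + L 0 = a := fun a L => by simp
  have e1 : (mfderiv (𝓘(ℝ, EG).prod I) I (fun p : G × M => p.1 • p.2) ((1 : G), x) :
      EG × E →L[ℝ] E) (ξ, 0) = infGeneratorL EG G I x ξ :=
    (mfderiv_prod_eq_add_apply (hs.mdifferentiable (by simp) ((1 : G), x))).trans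
      (e0 (infGeneratorL EG G I x ξ) (mfderiv I I (fun z : M => (1 : G) • z) x))
  -- the base point `1 • x` of the tangent vector is only propositionally equal to `x`
  have e2 : ∀ (y : M) (hy : y = x) (v w : E), w = v →
      (⟨x, v⟩ : TangentBundle I M) = ⟨y, w⟩ := by
    rintro _ rfl v _ rfl; rfl
  refine e2 _ (one_smul G x) _ _ e1

/-- The value of a `1`-form at a point, as a functional on the model space of the manifold. -/
noncomputable def OneForm.toModel [IsManifold I ∞ M] (f : OneForm I M) (x : M) : E →L[ℝ] ℝ := f x

/-- The pairing of a `1`-form with the infinitesimal generators, as a functional on the Lie algebra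
that depends on the point. -/
noncomputable def generatorPairing [IsManifold I ∞ M] (EG G : Type*) [NormedAddCommGroup EG]
    [NormedSpace ℝ EG] [TopologicalSpace G] [ChartedSpace EG G] [Group G] [MulAction G M]
    (f : OneForm I M) (x : M) : EG →L[ℝ] ℝ :=
  (f.toModel x).comp (infGeneratorL EG G I x)

lemma contMDiff_generatorPairing [FiniteDimensional ℝ EG] [IsManifold 𝓘(ℝ, EG) ∞ G]
    [IsManifold I ∞ M]
    (hs : ContMDiff (𝓘(ℝ, EG).prod I) I ∞ (fun p : G × M => p.1 • p.2)) (f : OneForm I M) :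
    ContMDiff I 𝓘(ℝ, EG →L[ℝ] ℝ) ∞ (generatorPairing EG G f) := by
  intro x
  refine contMDiffAt_clm_of_apply fun ξ => ?_
  have h := (f.contMDiff x).clm_bundle_apply (contMDiff_infGenerator hs ξ x)
  exact contMDiffAt_of_trivial_section (b := fun x : M => x) (IB := I)
    (s := fun x => generatorPairing EG G f x ξ) h

end Generators

/-! ### Smoothness of `Υ` and its local sections -/

section Upsilon

open IsPrincipalTrivialization

variable {EG : Type*} [NormedAddCommGroup EG] [NormedSpace ℝ EG]
  {EQ : Type*} [NormedAddCommGroup EQ] [NormedSpace ℝ EQ]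
  {EB : Type*} [NormedAddCommGroup EB] [NormedSpace ℝ EB]
  {G : Type*} [Group G] [TopologicalSpace G] [ChartedSpace EG G]
  {Q : Type*} [TopologicalSpace Q] [ChartedSpace EQ Q] [MulAction G Q]
  [ChartedSpace EB (MulAction.orbitRel.Quotient G Q)]

variable (EG EQ EB G Q) in
lemma contMDiff_orbitMap [IsPrincipalBundle EG EQ EB G Q] :
    ContMDiff 𝓘(ℝ, EQ) 𝓘(ℝ, EB) ∞ (orbitMap G Q) := by
  intro q
  set e := trivAt EG EQ EB (orbitMap G Q q)
  have he : IsPrincipalTrivialization EG EQ EB e := isPrincipal_trivAt _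
  have hq : q ∈ e.source := e.mem_source.2 (mem_trivAt _)
  have h := contMDiff_fst.comp_contMDiffOn he.contMDiffOn
  exact ((h.congr fun x hx => (e.proj_toFun x hx).symm) q hq).contMDiffAt
    (e.open_source.mem_nhds hq)

variable [LieGroup 𝓘(ℝ, EG) ∞ G] {e e' : Trivialization G (orbitMap G Q)}

variable [IsManifold 𝓘(ℝ, EB) ∞ (MulAction.orbitRel.Quotient G Q)]
  [IsPrincipalBundle EG EQ EB G Q]

lemma ConjugateBundle.contMDiffOn_localTriv_symm (he : IsPrincipalTrivialization EG EQ EB e) :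
    ContMDiffOn (𝓘(ℝ, EB).prod 𝓘(ℝ, EG)) (𝓘(ℝ, EB).prod 𝓘(ℝ, EG)) ∞
      (localTriv (EQ := EQ) e he).symm (localTriv (EQ := EQ) e he).target := by
  intro p hp
  refine ContMDiffAt.contMDiffWithinAt ?_
  set c' := chartAt (ModelProd EB EG) p
  have hc : (localTriv e he).trans c' ∈ IsManifold.maximalAtlas (𝓘(ℝ, EB).prod 𝓘(ℝ, EG)) ∞
      (ConjugateBundle EQ G Q) :=
    IsManifold.subset_maximalAtlas ⟨e, he, c', chart_mem_atlas _ _, rfl⟩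
  have h1 := contMDiffOn_symm_of_mem_maximalAtlas hc
  have h2 := contMDiffOn_chart (I := 𝓘(ℝ, EB).prod 𝓘(ℝ, EG)) (n := ∞) (x := p)
  have hp' : p ∈ c'.source := mem_chart_source _ _
  have h3 := h1.comp (s := c'.source ∩ (localTriv (EQ := EQ) e he).target) (h2.mono inter_subset_left)
    (fun x hx => ⟨c'.map_source hx.1, by
      change c'.symm (c' x) ∈ (localTriv (EQ := EQ) e he).target
      rw [c'.left_inv hx.1]
      exact hx.2⟩)
  refine ((h3.congr fun x hx => ?_) p ⟨hp', hp⟩).contMDiffAt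
    ((c'.open_source.inter (localTriv e he).open_target).mem_nhds ⟨hp', hp⟩)
  exact congrArg (localTriv e he).symm (c'.left_inv hx.1).symm

variable (EG EQ EB G Q) in
lemma ConjugateBundle.contMDiff_mk :
    ContMDiff (𝓘(ℝ, EQ).prod 𝓘(ℝ, EG)) (𝓘(ℝ, EB).prod 𝓘(ℝ, EG)) ∞
      (fun p : Q × G => ConjugateBundle.mk EQ p.1 p.2) := by
  rintro ⟨q, w⟩
  set e := trivAt EG EQ EB (orbitMap G Q q)
  have he : IsPrincipalTrivialization EG EQ EB e := isPrincipal_trivAt _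
  have hq : q ∈ e.source := e.mem_source.2 (mem_trivAt _)
  have h1 : ContMDiffOn (𝓘(ℝ, EQ).prod 𝓘(ℝ, EG)) 𝓘(ℝ, EG) ∞ (fun p : Q × G => (e p.1).2)
      (Prod.fst ⁻¹' e.source) :=
    (contMDiff_snd.comp_contMDiffOn he.contMDiffOn).comp contMDiffOn_fst fun _ h => h
  have h2 : ContMDiffOn (𝓘(ℝ, EQ).prod 𝓘(ℝ, EG)) 𝓘(ℝ, EB) ∞ (fun p : Q × G => orbitMap G Q p.1)
      (Prod.fst ⁻¹' e.source) :=
    ((contMDiff_orbitMap EG EQ EB G Q).comp contMDiff_fst).contMDiffOn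
  have h3 := (contMDiffOn_localTriv_symm he).comp
    (h2.prodMk ((h1.inv.mul contMDiffOn_snd).mul h1))
    (fun p hp => ⟨e.mem_source.1 hp, mem_univ _⟩)
  refine ((h3.congr fun p hp => ?_) (q, w) hq).contMDiffAt
    ((e.open_source.preimage continuous_fst).mem_nhds hq)
  have h4 := (localTriv (EQ := EQ) e he).left_inv (x := mk EQ p.1 p.2) (e.mem_source.1 hp)
  rw [localTriv_apply, coord_mk he hp] at h4
  exact h4.symm

variable (A : AffineDiscreteConnection EG EQ G Q)

namespace AffineDiscreteConnection

variable (EB) in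
lemma contMDiff_upsilon :
    ContMDiff (𝓘(ℝ, EQ).prod 𝓘(ℝ, EQ)) ((𝓘(ℝ, EB).prod 𝓘(ℝ, EG)).prod 𝓘(ℝ, EB)) ∞ A.upsilon :=
  ((ConjugateBundle.contMDiff_mk EG EQ EB G Q).comp
    (contMDiff_fst.prodMk A.contMDiff_toFun)).prodMk
    ((contMDiff_orbitMap EG EQ EB G Q).comp contMDiff_snd)

/-- The local section of `Υ` given by two trivializations of `π`. The first point is the local
section of `π`, and the second is moved along its orbit until the discrete connection takes the
prescribed value. -/
noncomputable def localLift (e e' : Trivialization G (orbitMap G Q))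
    (y : ConjugateBundle EQ G Q × MulAction.orbitRel.Quotient G Q) : Q × Q :=
  (localSection e y.1.proj,
    (ConjugateBundle.coord e y.1 *
      (A.toFun (localSection e y.1.proj, localSection e' y.2))⁻¹) • localSection e' y.2)

/-- The domain of the local section of `Υ` given by two trivializations of `π`. -/
def liftDomain (EQ : Type*) (e e' : Trivialization G (orbitMap G Q)) :
    Set (ConjugateBundle EQ G Q × MulAction.orbitRel.Quotient G Q) :=
  {y | y.1.proj ∈ e.baseSet ∧ y.2 ∈ e'.baseSet}

lemma isOpen_liftDomain : IsOpen (liftDomain EQ e e') :=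
  (e.open_baseSet.preimage (ConjugateBundle.continuous_proj.comp continuous_fst)).inter
    (e'.open_baseSet.preimage continuous_snd)

lemma upsilon_localLift (he : IsPrincipalTrivialization EG EQ EB e)
    {y : ConjugateBundle EQ G Q × MulAction.orbitRel.Quotient G Q} (hy : y ∈ liftDomain EQ e e') :
    A.upsilon (A.localLift e e' y) = y := by
  obtain ⟨v, b⟩ := y
  set q₀ := localSection e v.proj with hq₀
  set q₁ := localSection e' b with hq₁
  have h := A.map_smul_smul 1 (ConjugateBundle.coord e v * (A.toFun (q₀, q₁))⁻¹) q₀ q₁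
  rw [one_smul, inv_one, mul_one, inv_mul_cancel_right] at h
  refine Prod.ext ?_ ((orbitMap_smul _ _).trans (orbitMap_localSection hy.2))
  exact (congrArg (ConjugateBundle.mk EQ q₀) h).trans
    ((ConjugateBundle.localTriv (EQ := EQ) e he).left_inv hy.1)

/-- The trivialization of `π` used for the first factor measures the displacement of a point from
the local section of `Υ` through its orbit. -/
lemma smul_localLift_upsilon (he : IsPrincipalTrivialization EG EQ EB e) {q : Q × Q}
    (hq : A.upsilon q ∈ liftDomain EQ e e') :
    (e q.1).2 • A.localLift e e' (A.upsilon q) = q := by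
  obtain ⟨g, hg⟩ := A.upsilon_eq_iff.1 (A.upsilon_localLift he hq).symm
  have h1 : g • localSection e (orbitMap G Q q.1) = q.1 := congrArg Prod.fst hg
  have hb : orbitMap G Q q.1 ∈ e.baseSet := hq.1
  have h2 : (e q.1).2 = g := by
    conv_lhs => rw [← h1]
    rw [he.equivariant _ _ (localSection_mem hb), apply_localSection hb, mul_one]
  rw [h2]
  exact hg

lemma contMDiffOn_localLift (he : IsPrincipalTrivialization EG EQ EB e)
    (he' : IsPrincipalTrivialization EG EQ EB e') :
    ContMDiffOn ((𝓘(ℝ, EB).prod 𝓘(ℝ, EG)).prod 𝓘(ℝ, EB)) (𝓘(ℝ, EQ).prod 𝓘(ℝ, EQ)) ∞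
      (A.localLift e e') (liftDomain EQ e e') := by
  have h0 : ContMDiffOn ((𝓘(ℝ, EB).prod 𝓘(ℝ, EG)).prod 𝓘(ℝ, EB)) 𝓘(ℝ, EQ) ∞
      (fun y : ConjugateBundle EQ G Q × MulAction.orbitRel.Quotient G Q =>
        localSection e y.1.proj) (liftDomain EQ e e') :=
    he.contMDiffOn_localSection.comp
      (ConjugateBundle.contMDiff_proj.comp contMDiff_fst).contMDiffOn fun _ hy => hy.1
  have h1 : ContMDiffOn ((𝓘(ℝ, EB).prod 𝓘(ℝ, EG)).prod 𝓘(ℝ, EB)) 𝓘(ℝ, EQ) ∞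
      (fun y : ConjugateBundle EQ G Q × MulAction.orbitRel.Quotient G Q =>
        localSection e' y.2) (liftDomain EQ e e') :=
    he'.contMDiffOn_localSection.comp contMDiffOn_snd fun _ hy => hy.2
  have hk : ContMDiffOn ((𝓘(ℝ, EB).prod 𝓘(ℝ, EG)).prod 𝓘(ℝ, EB)) 𝓘(ℝ, EG) ∞
      (fun y : ConjugateBundle EQ G Q × MulAction.orbitRel.Quotient G Q =>
        ConjugateBundle.coord e y.1) (liftDomain EQ e e') :=
    (contMDiff_snd.comp_contMDiffOn (ConjugateBundle.contMDiffOn_localTriv he)).comp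
      contMDiffOn_fst fun _ hy => hy.1
  have hA := A.contMDiff_toFun.comp_contMDiffOn (h0.prodMk h1)
  exact h0.prodMk ((IsPrincipalBundle.contMDiff_smul (EG := EG) (EQ := EQ) (EB := EB) (G := G)
    (Q := Q)).comp_contMDiffOn ((hk.mul hA.inv).prodMk h1))

end AffineDiscreteConnection

end Upsilon

/-! ### The splitting of `T(Q × Q)` -/

section Splitting

/-- The chain rule for differentials regarded as maps of the model spaces, with a propositional
identification of the intermediate point. -/
lemma mfderiv_comp_model {E E' E'' H H' H'' M M' M'' : Type*}
    [NormedAddCommGroup E] [NormedSpace ℝ E] [NormedAddCommGroup E'] [NormedSpace ℝ E']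
    [NormedAddCommGroup E''] [NormedSpace ℝ E'']
    [TopologicalSpace H] [TopologicalSpace H'] [TopologicalSpace H'']
    {I : ModelWithCorners ℝ E H} {I' : ModelWithCorners ℝ E' H'} {I'' : ModelWithCorners ℝ E'' H''}
    [TopologicalSpace M] [ChartedSpace H M] [TopologicalSpace M'] [ChartedSpace H' M']
    [TopologicalSpace M''] [ChartedSpace H'' M''] {g : M' → M''} {f : M → M'} {x : M} {y : M'}
    (hg : MDifferentiableAt I' I'' g y) (hf : MDifferentiableAt I I' f x) (hy : f x = y) (v : E) :
    (mfderiv I I'' (fun z => g (f z)) x : E →L[ℝ] E'') v =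
      (mfderiv I' I'' g y : E' →L[ℝ] E'') ((mfderiv I I' f x : E →L[ℝ] E') v) := by
  subst hy
  exact congrArg (fun L : E →L[ℝ] E'' => L v) (mfderiv_comp x hg hf)

open IsPrincipalTrivialization

variable {EG : Type*} [NormedAddCommGroup EG] [NormedSpace ℝ EG]
  {EQ : Type*} [NormedAddCommGroup EQ] [NormedSpace ℝ EQ]
  {EB : Type*} [NormedAddCommGroup EB] [NormedSpace ℝ EB]
  {G : Type*} [Group G] [TopologicalSpace G] [ChartedSpace EG G]
  {Q : Type*} [TopologicalSpace Q] [ChartedSpace EQ Q] [MulAction G Q]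
  [ChartedSpace EB (MulAction.orbitRel.Quotient G Q)]

variable (EG EQ EB G Q) in
lemma contMDiff_smul_prod [IsPrincipalBundle EG EQ EB G Q] :
    ContMDiff (𝓘(ℝ, EG).prod (𝓘(ℝ, EQ).prod 𝓘(ℝ, EQ))) (𝓘(ℝ, EQ).prod 𝓘(ℝ, EQ)) ∞
      (fun p : G × (Q × Q) => p.1 • p.2) := by
  have h := IsPrincipalBundle.contMDiff_smul (EG := EG) (EQ := EQ) (EB := EB) (G := G) (Q := Q)
  exact (h.comp (contMDiff_fst.prodMk (contMDiff_fst.comp contMDiff_snd))).prodMk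
    (h.comp (contMDiff_fst.prodMk (contMDiff_snd.comp contMDiff_snd)))

variable [LieGroup 𝓘(ℝ, EG) ∞ G] [IsManifold 𝓘(ℝ, EB) ∞ (MulAction.orbitRel.Quotient G Q)]
  [IsPrincipalBundle EG EQ EB G Q] (A : AffineDiscreteConnection EG EQ G Q)

namespace AffineDiscreteConnection

variable (EB) in
/-- The tangent map of `Υ`, as a map of the model spaces. -/
noncomputable def dUpsilon (q : Q × Q) : EQ × EQ →L[ℝ] (EB × EG) × EB := A.tangentUpsilon EB q

variable (EB) in
lemma mdifferentiableAt_upsilon (q : Q × Q) : MDifferentiableAt (𝓘(ℝ, EQ).prod 𝓘(ℝ, EQ))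
    ((𝓘(ℝ, EB).prod 𝓘(ℝ, EG)).prod 𝓘(ℝ, EB)) A.upsilon q :=
  (A.contMDiff_upsilon EB).mdifferentiable (by simp) q

lemma upsilon_smul (g : G) (q : Q × Q) : A.upsilon (g • q) = A.upsilon q :=
  A.upsilon_eq_iff.2 ⟨g, rfl⟩

lemma dUpsilon_infGenerator (q : Q × Q) (ξ : EG) :
    A.dUpsilon EB q (infGeneratorL EG G (𝓘(ℝ, EQ).prod 𝓘(ℝ, EQ)) q ξ) = 0 := by
  have h := mfderiv_comp_model (x := (1 : G)) (A.mdifferentiableAt_upsilon EB q)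
    (mdifferentiableAt_orbit (contMDiff_smul_prod EG EQ EB G Q) q 1) (one_smul G q) ξ
  refine h.symm.trans ?_
  have hc : (fun g : G => A.upsilon (g • q)) = fun _ => A.upsilon q :=
    funext fun g => A.upsilon_smul g q
  rw [hc, mfderiv_const]
  rfl

lemma dUpsilon_smul (g : G) (q : Q × Q) (v : EQ × EQ) :
    A.dUpsilon EB (g • q) ((mfderiv (𝓘(ℝ, EQ).prod 𝓘(ℝ, EQ)) (𝓘(ℝ, EQ).prod 𝓘(ℝ, EQ))
      (fun x : Q × Q => g • x) q : EQ × EQ →L[ℝ] EQ × EQ) v) = A.dUpsilon EB q v := by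
  have h := mfderiv_comp_model (x := q) (A.mdifferentiableAt_upsilon EB (g • q))
    (mdifferentiableAt_smul (contMDiff_smul_prod EG EQ EB G Q) g q) rfl v
  refine h.symm.trans ?_
  have hc : (fun x : Q × Q => A.upsilon (g • x)) = A.upsilon :=
    funext fun x => A.upsilon_smul g x
  rw [hc]
  rfl

variable (EB) in
/-- `TΥ` has a right inverse at each point, and its kernel consists of infinitesimal generators.
Locally `q = θ(q) • σ(Υ(q))` for a local section `σ` of `Υ` and a smooth `G`-valued map `θ`; the
derivative of this identity is the asserted decomposition. -/
lemma exists_rightInverse_dUpsilon (q : Q × Q) :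
    ∃ S : (EB × EG) × EB →L[ℝ] EQ × EQ, (∀ u, A.dUpsilon EB q (S u) = u) ∧
      ∀ v, ∃ ξ, v = S (A.dUpsilon EB q v) + infGeneratorL EG G (𝓘(ℝ, EQ).prod 𝓘(ℝ, EQ)) q ξ := by
  have hs := contMDiff_smul_prod EG EQ EB G Q
  set e := trivAt EG EQ EB (orbitMap G Q q.1)
  set e' := trivAt EG EQ EB (orbitMap G Q q.2)
  have he : IsPrincipalTrivialization EG EQ EB e := isPrincipal_trivAt _
  have he' : IsPrincipalTrivialization EG EQ EB e' := isPrincipal_trivAt _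
  have hy : A.upsilon q ∈ liftDomain EQ e e' := ⟨mem_trivAt _, mem_trivAt _⟩
  have hq : q.1 ∈ e.source := e.mem_source.2 (mem_trivAt _)
  have hyn : liftDomain EQ e e' ∈ 𝓝 (A.upsilon q) := isOpen_liftDomain.mem_nhds hy
  have hqn : A.upsilon ⁻¹' liftDomain EQ e e' ∈ 𝓝 q :=
    (isOpen_liftDomain.preimage (A.contMDiff_upsilon EB).continuous).mem_nhds hy
  set σ := A.localLift e e'
  have hσ : MDifferentiableAt ((𝓘(ℝ, EB).prod 𝓘(ℝ, EG)).prod 𝓘(ℝ, EB)) (𝓘(ℝ, EQ).prod 𝓘(ℝ, EQ))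
      σ (A.upsilon q) := ((A.contMDiffOn_localLift he he').contMDiffAt hyn).mdifferentiableAt
        (by simp)
  have hσΥ : MDifferentiableAt (𝓘(ℝ, EQ).prod 𝓘(ℝ, EQ)) (𝓘(ℝ, EQ).prod 𝓘(ℝ, EQ))
      (fun x => σ (A.upsilon x)) q := hσ.comp q (A.mdifferentiableAt_upsilon EB q)
  have hθ : MDifferentiableAt (𝓘(ℝ, EQ).prod 𝓘(ℝ, EQ)) 𝓘(ℝ, EG) (fun x : Q × Q => (e x.1).2) q := by
    have h1 : ContMDiffAt 𝓘(ℝ, EQ) (𝓘(ℝ, EB).prod 𝓘(ℝ, EG)) ∞ e q.1 :=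
      he.contMDiffOn.contMDiffAt (e.open_source.mem_nhds hq)
    exact (contMDiffAt_snd.comp q (h1.comp q contMDiffAt_fst)).mdifferentiableAt (by simp)
  have hθσ : (e q.1).2 • σ (A.upsilon q) = q := A.smul_localLift_upsilon he hy
  have hl := mdifferentiableAt_smul hs (e q.1).2 (σ (A.upsilon q))
  have hS : MDifferentiableAt ((𝓘(ℝ, EB).prod 𝓘(ℝ, EG)).prod 𝓘(ℝ, EB)) (𝓘(ℝ, EQ).prod 𝓘(ℝ, EQ))
      (fun y => (e q.1).2 • σ y) (A.upsilon q) := hl.comp _ hσ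
  -- the right inverse is the derivative of the local section translated so as to pass through `q`
  refine ⟨mfderiv ((𝓘(ℝ, EB).prod 𝓘(ℝ, EG)).prod 𝓘(ℝ, EB)) (𝓘(ℝ, EQ).prod 𝓘(ℝ, EQ))
    (fun y => (e q.1).2 • σ y) (A.upsilon q), fun u => ?_, fun v => ?_⟩
  · have h := mfderiv_comp_model (A.mdifferentiableAt_upsilon EB q) hS hθσ u
    refine h.symm.trans ?_
    have hid : (fun y => A.upsilon ((e q.1).2 • σ y)) =ᶠ[𝓝 (A.upsilon q)] id := by
      filter_upwards [hyn] with y hy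
      rw [upsilon_smul]
      exact A.upsilon_localLift he hy
    rw [hid.mfderiv_eq]
    exact congrArg (fun L : (EB × EG) × EB →L[ℝ] (EB × EG) × EB => L u) mfderiv_id
  · refine ⟨(mfderiv 𝓘(ℝ, EG) 𝓘(ℝ, EG) (fun k : G => k * (e q.1).2⁻¹) (e q.1).2 : EG →L[ℝ] EG)
      ((mfderiv (𝓘(ℝ, EQ).prod 𝓘(ℝ, EQ)) 𝓘(ℝ, EG) (fun x : Q × Q => (e x.1).2) q :
        EQ × EQ →L[ℝ] EG) v), ?_⟩
    have h1 := mfderiv_orbit_eq_infGenerator hs (σ (A.upsilon q)) (e q.1).2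
      ((mfderiv (𝓘(ℝ, EQ).prod 𝓘(ℝ, EQ)) 𝓘(ℝ, EG) (fun x : Q × Q => (e x.1).2) q :
        EQ × EQ →L[ℝ] EG) v)
    rw [hθσ] at h1
    have h2 := mfderiv_comp_model hS (A.mdifferentiableAt_upsilon EB q) rfl v
    have h3 := mfderiv_comp_model hl hσΥ rfl v
    rw [← h1]
    refine Eq.trans ?_ (congrArg₂ (HAdd.hAdd : EQ × EQ → EQ × EQ → EQ × EQ) (h3.symm.trans h2) rfl)
    -- differentiate `q = θ(q) • σ(Υ(q))` by the product rule for the action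
    have hid : (fun x : Q × Q => (e x.1).2 • σ (A.upsilon x)) =ᶠ[𝓝 q] id := by
      filter_upwards [hqn] with x hx
      exact A.smul_localLift_upsilon he hx
    have h4 := mfderiv_comp_model (x := q) (hs.mdifferentiable (by simp)
      ((e q.1).2, σ (A.upsilon q))) (hθ.prodMk hσΥ) rfl v
    rw [hid.mfderiv_eq] at h4
    have h5 : (mfderiv (𝓘(ℝ, EQ).prod 𝓘(ℝ, EQ)) (𝓘(ℝ, EQ).prod 𝓘(ℝ, EQ)) id q :
      EQ × EQ →L[ℝ] EQ × EQ) v = v :=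
      congrArg (fun L : EQ × EQ →L[ℝ] EQ × EQ => L v) mfderiv_id
    refine (h5.symm.trans h4).trans ?_
    rw [mfderiv_prodMk hθ hσΥ]
    refine Eq.trans (mfderiv_prod_eq_add_apply (hs.mdifferentiable (by simp)
      ((e q.1).2, σ (A.upsilon q)))) ?_
    exact add_comm (G := EQ × EQ) _ _

end AffineDiscreteConnection

end Splitting

section Reduction

open IsPrincipalTrivialization AffineDiscreteConnection

variable {EG : Type*} [NormedAddCommGroup EG] [NormedSpace ℝ EG]
  {EQ : Type*} [NormedAddCommGroup EQ] [NormedSpace ℝ EQ]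
  {EB : Type*} [NormedAddCommGroup EB] [NormedSpace ℝ EB]
  {G : Type*} [Group G] [TopologicalSpace G] [ChartedSpace EG G] [LieGroup 𝓘(ℝ, EG) ∞ G]
  {Q : Type*} [TopologicalSpace Q] [ChartedSpace EQ Q] [IsManifold 𝓘(ℝ, EQ) ∞ Q] [MulAction G Q]
  [ChartedSpace EB (MulAction.orbitRel.Quotient G Q)]
  [IsManifold 𝓘(ℝ, EB) ∞ (MulAction.orbitRel.Quotient G Q)]
  [IsPrincipalBundle EG EQ EB G Q] (A : AffineDiscreteConnection EG EQ G Q)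
  (𝔄 : PrincipalConnection EG G (𝓘(ℝ, EQ).prod 𝓘(ℝ, EQ)) (Q × Q))
  (f : OneForm (𝓘(ℝ, EQ).prod 𝓘(ℝ, EQ)) (Q × Q))

/-- The value of a principal connection on `Q × Q` at a point, as a map of the model spaces. -/
noncomputable def PrincipalConnection.toModel (q : Q × Q) : EQ × EQ →L[ℝ] EG := 𝔄.form q

lemma PrincipalConnection.toModel_infGenerator (q : Q × Q) (ξ : EG) :
    𝔄.toModel q (infGeneratorL EG G (𝓘(ℝ, EQ).prod 𝓘(ℝ, EQ)) q ξ) = ξ :=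
  𝔄.form_infGenerator ξ q

/-- The principal connection splits `TΥ`: subtracting the vertical part from a right inverse of `TΥ`
gives the horizontal lift. -/
lemma exists_horizontalLift (q : Q × Q) :
    ∃ h : (EB × EG) × EB →L[ℝ] EQ × EQ, (∀ u, A.dUpsilon EB q (h u) = u) ∧
      ∀ v, v = h (A.dUpsilon EB q v) +
        infGeneratorL EG G (𝓘(ℝ, EQ).prod 𝓘(ℝ, EQ)) q (𝔄.toModel q v) := by
  obtain ⟨S, hS, hv⟩ := A.exists_rightInverse_dUpsilon EB q
  refine ⟨S - (infGeneratorL EG G (𝓘(ℝ, EQ).prod 𝓘(ℝ, EQ)) q).comp ((𝔄.toModel q).comp S),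
    fun u => ?_, fun v => ?_⟩
  · simp [hS, dUpsilon_infGenerator]
  · obtain ⟨ξ, hξ⟩ := hv v
    have h1 : 𝔄.toModel q v = 𝔄.toModel q (S (A.dUpsilon EB q v)) + ξ := by
      conv_lhs => rw [hξ, map_add, 𝔄.toModel_infGenerator]
    rw [h1]
    conv_lhs => rw [hξ]
    simp only [sub_apply, ContinuousLinearMap.comp_apply, map_add]
    abel

variable (EB) in
/-- The horizontal lift to `T_q(Q × Q)` of tangent vectors of `G̃ × Q/G` at `Υ(q)`, as a map of the
model spaces. -/
noncomputable def horizontalLift (q : Q × Q) : (EB × EG) × EB →L[ℝ] EQ × EQ :=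
  (exists_horizontalLift (EB := EB) A 𝔄 q).choose

lemma dUpsilon_horizontalLift (q : Q × Q) (u : (EB × EG) × EB) :
    A.dUpsilon EB q (horizontalLift EB A 𝔄 q u) = u :=
  (exists_horizontalLift A 𝔄 q).choose_spec.1 u

lemma horizontalLift_add_vertical (q : Q × Q) (v : EQ × EQ) :
    horizontalLift EB A 𝔄 q (A.dUpsilon EB q v) +
      infGeneratorL EG G (𝓘(ℝ, EQ).prod 𝓘(ℝ, EQ)) q (𝔄.toModel q v) = v :=
  ((exists_horizontalLift A 𝔄 q).choose_spec.2 v).symm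

/-- `TΥ ⊕ 𝔄` is a linear isomorphism from `T_q(Q × Q)` onto the sum of the model spaces of
`G̃ × Q/G` and of `𝔤`. -/
lemma existsUnique_dUpsilon_eq (q : Q × Q) (u : (EB × EG) × EB) (ξ : EG) :
    ∃! v : EQ × EQ, A.dUpsilon EB q v = u ∧ 𝔄.toModel q v = ξ := by
  set v₀ := horizontalLift EB A 𝔄 q u + infGeneratorL EG G (𝓘(ℝ, EQ).prod 𝓘(ℝ, EQ)) q
    (ξ - 𝔄.toModel q (horizontalLift EB A 𝔄 q u)) with hv₀
  refine ⟨v₀, ⟨?_, ?_⟩, ?_⟩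
  · rw [hv₀, map_add, dUpsilon_horizontalLift (EB := EB), dUpsilon_infGenerator, add_zero]
  · rw [hv₀, map_add, 𝔄.toModel_infGenerator, add_sub_cancel]
  · rintro v ⟨rfl, rfl⟩
    -- the horizontal lift of `TΥ v` has no vertical part, by the decomposition of the lift itself
    have h := horizontalLift_add_vertical (EB := EB) A 𝔄 q (horizontalLift EB A 𝔄 q (A.dUpsilon EB q v))
    rw [dUpsilon_horizontalLift, add_eq_left] at h
    rw [hv₀, map_sub, h, sub_zero, horizontalLift_add_vertical]

lemma HatG.existsUnique_tangentUpsilon_eq (q : Q × Q)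
    (u : TangentSpace ((𝓘(ℝ, EB).prod 𝓘(ℝ, EG)).prod 𝓘(ℝ, EB)) (A.upsilon q))
    (η : HatG EB A (A.upsilon q)) :
    ∃! δq : TangentSpace (𝓘(ℝ, EQ).prod 𝓘(ℝ, EQ)) q,
      A.tangentUpsilon EB q δq = u ∧ HatG.mk EB A q (𝔄.apply q δq) = η := by
  obtain ⟨ξ, rfl⟩ := (HatG.fibreEquiv EB A q rfl).surjective η
  obtain ⟨v, ⟨h1, h2⟩, h3⟩ := existsUnique_dUpsilon_eq (EB := EB) A 𝔄 q u ξ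
  refine ⟨v, ⟨h1, congrArg (HatG.mk EB A q) h2⟩, fun w hw => h3 w ⟨hw.1, ?_⟩⟩
  exact (HatG.fibreEquiv EB A q rfl).injective hw.2

/-! ### The reduced section at a point -/

/-- Equivariance in terms of push-forward: `f(g • q)(T l_g v) = f(q)(v)`. -/
lemma OneForm.IsEquivariant.toModel_smul {f : OneForm (𝓘(ℝ, EQ).prod 𝓘(ℝ, EQ)) (Q × Q)}
    (hs : ContMDiff (𝓘(ℝ, EG).prod (𝓘(ℝ, EQ).prod 𝓘(ℝ, EQ))) (𝓘(ℝ, EQ).prod 𝓘(ℝ, EQ)) ∞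
      (fun p : G × (Q × Q) => p.1 • p.2))
    (hf : f.IsEquivariant G) (g : G) (q : Q × Q) (v : EQ × EQ) :
    f.toModel (g • q) ((mfderiv (𝓘(ℝ, EQ).prod 𝓘(ℝ, EQ)) (𝓘(ℝ, EQ).prod 𝓘(ℝ, EQ))
      (fun x : Q × Q => g • x) q : EQ × EQ →L[ℝ] EQ × EQ) v) = f.toModel q v := by
  have h1 : f.toModel (g • q) = (f.toModel q).comp
      (mfderiv (𝓘(ℝ, EQ).prod 𝓘(ℝ, EQ)) (𝓘(ℝ, EQ).prod 𝓘(ℝ, EQ))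
        (fun x : Q × Q => g⁻¹ • x) (g • q) : EQ × EQ →L[ℝ] EQ × EQ) := hf g q
  have h2 := mfderiv_comp_model (x := q) (mdifferentiableAt_smul hs g⁻¹ (g • q))
    (mdifferentiableAt_smul hs g q) rfl v
  have hc : (fun x : Q × Q => g⁻¹ • g • x) = id := funext fun x => inv_smul_smul g x
  rw [hc] at h2
  have h3 : (mfderiv (𝓘(ℝ, EQ).prod 𝓘(ℝ, EQ)) (𝓘(ℝ, EQ).prod 𝓘(ℝ, EQ)) id q :
      EQ × EQ →L[ℝ] EQ × EQ) v = v :=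
    congrArg (fun L : EQ × EQ →L[ℝ] EQ × EQ => L v) mfderiv_id
  rw [h1]
  exact congrArg (f.toModel q) (h2.symm.trans h3)

variable {y : ConjugateBundle EQ G Q × MulAction.orbitRel.Quotient G Q}

variable (EB) in
/-- The component in `T*(G̃ × Q/G)` of the reduced section: the horizontal part of the `1`-form,
computed at the chosen point over `y`. -/
noncomputable def reducedHorizontal
    (y : ConjugateBundle EQ G Q × MulAction.orbitRel.Quotient G Q) : (EB × EG) × EB →L[ℝ] ℝ :=
  (f.toModel (HatG.rep A y)).comp (horizontalLift EB A 𝔄 (HatG.rep A y))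

variable (EB) in
/-- The component in `ĝ*` of the reduced section: the vertical part of the `1`-form, computed at the
chosen point over `y`. -/
noncomputable def reducedVertical
    (y : ConjugateBundle EQ G Q × MulAction.orbitRel.Quotient G Q) : HatG EB A y →L[ℝ] ℝ where
  toFun η := generatorPairing EG G f (HatG.rep A y) (HatG.repEquiv EB A y η)
  map_add' a b := by rw [HatG.repEquiv_add]; exact map_add (generatorPairing EG G f _) _ _
  map_smul' c a := by rw [HatG.repEquiv_smul]; exact map_smul (generatorPairing EG G f _) _ _
  cont := (generatorPairing EG G f _).continuous.comp continuous_induced_dom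

/-- By equivariance, the two components reproduce the `1`-form at every point over `y`, and not only
at the chosen one. -/
lemma reducedHorizontal_add_reducedVertical {f : OneForm (𝓘(ℝ, EQ).prod 𝓘(ℝ, EQ)) (Q × Q)}
    (hf : f.IsEquivariant G) {q : Q × Q} (hq : A.upsilon q = y) (v : EQ × EQ) :
    reducedHorizontal EB A 𝔄 f y (A.dUpsilon EB q v) +
      reducedVertical EB A f y (HatG.fibreEquiv EB A q hq (𝔄.toModel q v)) = f.toModel q v := by
  subst hq
  obtain ⟨g, hg⟩ := HatG.exists_smul_eq_rep (A := A) q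
  have h1 : HatG.repEquiv EB A (A.upsilon q) (HatG.fibreEquiv EB A q rfl (𝔄.toModel q v)) =
      Ad g (𝔄.toModel q v : GroupLieAlgebra 𝓘(ℝ, EG) G) := HatG.repEquiv_mk hg _
  have h2 := 𝔄.form_smul g q v
  have h3 := hf.toModel_smul (contMDiff_smul_prod EG EQ EB G Q) g q v
  have h4 := A.dUpsilon_smul (EB := EB) g q v
  -- `w` is the translate of `v` to the chosen point; it has the same image under `TΥ`
  set w : EQ × EQ := (mfderiv (𝓘(ℝ, EQ).prod 𝓘(ℝ, EQ)) (𝓘(ℝ, EQ).prod 𝓘(ℝ, EQ))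
      (fun x : Q × Q => g • x) q : EQ × EQ →L[ℝ] EQ × EQ) v
  have h5 : 𝔄.toModel (g • q) w = (Ad g (𝔄.toModel q v : GroupLieAlgebra 𝓘(ℝ, EG) G) : EG) := h2
  change f.toModel (HatG.rep A (A.upsilon q))
      (horizontalLift EB A 𝔄 (HatG.rep A (A.upsilon q)) (A.dUpsilon EB q v)) +
    f.toModel (HatG.rep A (A.upsilon q)) (infGeneratorL EG G (𝓘(ℝ, EQ).prod 𝓘(ℝ, EQ))
      (HatG.rep A (A.upsilon q)) (HatG.repEquiv EB A (A.upsilon q)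
        (HatG.fibreEquiv EB A q rfl (𝔄.toModel q v)))) = _
  rw [h1, ← hg, ← h4, ← h3, ← map_add]
  refine congrArg (f.toModel (g • q)) ?_
  conv_rhs => rw [← horizontalLift_add_vertical (EB := EB) A 𝔄 (g • q) w]
  rw [h5]

/-- The component in `ĝ*` is, at every point `q` over `y`, the map `[q, ξ] ↦ f(q)(ξ_{Q × Q})`. The
connection enters only the proof. -/
lemma reducedVertical_fibreEquiv {f : OneForm (𝓘(ℝ, EQ).prod 𝓘(ℝ, EQ)) (Q × Q)}
    (𝔄 : PrincipalConnection EG G (𝓘(ℝ, EQ).prod 𝓘(ℝ, EQ)) (Q × Q))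
    (hf : f.IsEquivariant G) {q : Q × Q} (hq : A.upsilon q = y) (ξ : EG) :
    reducedVertical EB A f y (HatG.fibreEquiv EB A q hq ξ) = generatorPairing EG G f q ξ := by
  have h := reducedHorizontal_add_reducedVertical (EB := EB) A 𝔄 hf hq
    (infGeneratorL EG G (𝓘(ℝ, EQ).prod 𝓘(ℝ, EQ)) q ξ)
  rwa [dUpsilon_infGenerator, map_zero, zero_add, 𝔄.toModel_infGenerator] at h

/-! ### Smoothness of the reduced section -/

lemma HatG.coord_fibreEquiv {e : Trivialization G (orbitMap G Q)}
    (he : IsPrincipalTrivialization EG EQ EB e) {q : Q × Q} (hq : q.1 ∈ e.source)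
    (h : A.upsilon q = y) (ξ : GroupLieAlgebra 𝓘(ℝ, EG) G) :
    HatG.coord e (HatG.fibreEquiv EB A q h ξ) = Ad (e q.1).2⁻¹ ξ := by
  subst h
  exact HatG.coord_mk he hq ξ

/-- In the preferred trivialization of `ĝ`, the constant local frames are the classes of constant
elements of `𝔤` along a local section of `Υ`, since the first component of that section is the unit
section of the trivialization of `π`. -/
lemma HatG.trivializationAt_symm {y₀ : ConjugateBundle EQ G Q × MulAction.orbitRel.Quotient G Q}
    {e' : Trivialization G (orbitMap G Q)}
    (hy : y ∈ liftDomain EQ (trivAt EG EQ EB y₀.1.proj) e') (ξ : EG)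
    (h : A.upsilon (A.localLift (trivAt EG EQ EB y₀.1.proj) e' y) = y) :
    (trivializationAt EG (HatG EB A) y₀).symm y ξ =
      HatG.fibreEquiv EB A (A.localLift (trivAt EG EQ EB y₀.1.proj) e' y) h ξ := by
  set e := trivAt EG EQ EB y₀.1.proj
  have he : IsPrincipalTrivialization EG EQ EB e := isPrincipal_trivAt _
  have h1 : (trivializationAt EG (HatG EB A) y₀
      ⟨y, HatG.fibreEquiv EB A (A.localLift e e' y) h ξ⟩).2 = ξ := by
    refine (HatG.coord_fibreEquiv A he (localSection_mem hy.1) h ξ).trans ?_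
    rw [show (e (A.localLift e e' y).1) = (y.1.proj, 1) from apply_localSection hy.1, inv_one,
      Ad_one]
    rfl
  have h2 := (trivializationAt EG (HatG EB A) y₀).symm_proj_apply
    ⟨y, HatG.fibreEquiv EB A (A.localLift e e' y) h ξ⟩ hy.1
  rwa [h1] at h2

lemma contMDiffAt_reducedVertical [FiniteDimensional ℝ EG]
    {f : OneForm (𝓘(ℝ, EQ).prod 𝓘(ℝ, EQ)) (Q × Q)}
    (𝔄 : PrincipalConnection EG G (𝓘(ℝ, EQ).prod 𝓘(ℝ, EQ)) (Q × Q)) (hf : f.IsEquivariant G)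
    (y₀ : ConjugateBundle EQ G Q × MulAction.orbitRel.Quotient G Q) :
    ContMDiffAt ((𝓘(ℝ, EB).prod 𝓘(ℝ, EG)).prod 𝓘(ℝ, EB))
      (((𝓘(ℝ, EB).prod 𝓘(ℝ, EG)).prod 𝓘(ℝ, EB)).prod 𝓘(ℝ, EG →L[ℝ] ℝ)) ∞
      (fun y => TotalSpace.mk' (EG →L[ℝ] ℝ)
        (E := fun y => HatG EB A y →L[ℝ] Bundle.Trivial _ ℝ y) y (reducedVertical EB A f y)) y₀ := by
  refine contMDiffAt_dual_section fun ξ => ?_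
  set e := trivAt EG EQ EB y₀.1.proj
  set e' := trivAt EG EQ EB y₀.2
  have he : IsPrincipalTrivialization EG EQ EB e := isPrincipal_trivAt _
  have hU : liftDomain EQ e e' ∈ 𝓝 y₀ :=
    isOpen_liftDomain.mem_nhds ⟨mem_trivAt _, mem_trivAt _⟩
  have hσ := (A.contMDiffOn_localLift he (e' := e') (isPrincipal_trivAt _)).contMDiffAt hU
  have h1 := ((contMDiff_generatorPairing (contMDiff_smul_prod EG EQ EB G Q) f).contMDiffAt.comp
    y₀ hσ).clm_apply (contMDiffAt_const (c := ξ))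
  refine h1.congr_of_eventuallyEq ?_
  filter_upwards [hU] with y hy
  have hy' := A.upsilon_localLift he hy
  exact (congrArg (reducedVertical EB A f y) (HatG.trivializationAt_symm A hy ξ hy')).trans
    (reducedVertical_fibreEquiv A 𝔄 hf hy' ξ)

lemma contMDiffAt_reducedHorizontal [FiniteDimensional ℝ EG] [FiniteDimensional ℝ EB]
    {f : OneForm (𝓘(ℝ, EQ).prod 𝓘(ℝ, EQ)) (Q × Q)} (hf : f.IsEquivariant G)
    (y₀ : ConjugateBundle EQ G Q × MulAction.orbitRel.Quotient G Q) :
    ContMDiffAt ((𝓘(ℝ, EB).prod 𝓘(ℝ, EG)).prod 𝓘(ℝ, EB))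
      (((𝓘(ℝ, EB).prod 𝓘(ℝ, EG)).prod 𝓘(ℝ, EB)).prod 𝓘(ℝ, ((EB × EG) × EB) →L[ℝ] ℝ)) ∞
      (fun y => TotalSpace.mk' (((EB × EG) × EB) →L[ℝ] ℝ)
        (E := fun y : ConjugateBundle EQ G Q × MulAction.orbitRel.Quotient G Q =>
          TangentSpace ((𝓘(ℝ, EB).prod 𝓘(ℝ, EG)).prod 𝓘(ℝ, EB)) y →L[ℝ] Bundle.Trivial _ ℝ y)
        y (reducedHorizontal EB A 𝔄 f y)) y₀ := by
  refine contMDiffAt_dual_section (E := fun y : ConjugateBundle EQ G Q ×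
    MulAction.orbitRel.Quotient G Q =>
      TangentSpace ((𝓘(ℝ, EB).prod 𝓘(ℝ, EG)).prod 𝓘(ℝ, EB)) y) fun u => ?_
  set e := trivAt EG EQ EB y₀.1.proj
  set e' := trivAt EG EQ EB y₀.2
  have he : IsPrincipalTrivialization EG EQ EB e := isPrincipal_trivAt _
  have he' : IsPrincipalTrivialization EG EQ EB e' := isPrincipal_trivAt _
  have hy₀ : y₀ ∈ liftDomain EQ e e' := ⟨mem_trivAt _, mem_trivAt _⟩
  have hU : liftDomain EQ e e' ∈ 𝓝 y₀ := isOpen_liftDomain.mem_nhds hy₀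
  have hσ := A.contMDiffOn_localLift he he'
  set σ := A.localLift e e'
  set t := trivializationAt ((EB × EG) × EB) (fun y : ConjugateBundle EQ G Q ×
    MulAction.orbitRel.Quotient G Q =>
      TangentSpace ((𝓘(ℝ, EB).prod 𝓘(ℝ, EG)).prod 𝓘(ℝ, EB)) y) y₀
  have ht : t.baseSet ∈ 𝓝 y₀ := t.open_baseSet.mem_nhds (mem_baseSet_trivializationAt _ _ y₀)
  -- the constant local frame of the tangent bundle of `G̃ × Q/G`
  have hX : ContMDiffAt ((𝓘(ℝ, EB).prod 𝓘(ℝ, EG)).prod 𝓘(ℝ, EB))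
      (((𝓘(ℝ, EB).prod 𝓘(ℝ, EG)).prod 𝓘(ℝ, EB)).prod 𝓘(ℝ, (EB × EG) × EB)) ∞
      (fun y => (⟨y, t.symm y u⟩ :
        TangentBundle ((𝓘(ℝ, EB).prod 𝓘(ℝ, EG)).prod 𝓘(ℝ, EB)) _)) y₀ := by
    refine (t.contMDiffAt_section_iff (mem_baseSet_trivializationAt _ _ y₀)).2 ?_
    refine (contMDiffAt_const (c := u)).congr_of_eventuallyEq ?_
    filter_upwards [ht] with y hy
    exact congrArg Prod.snd (t.apply_mk_symm hy u)
  -- its image under the tangent map of the local section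
  have hδ : ContMDiffAt ((𝓘(ℝ, EB).prod 𝓘(ℝ, EG)).prod 𝓘(ℝ, EB))
      ((𝓘(ℝ, EQ).prod 𝓘(ℝ, EQ)).prod 𝓘(ℝ, EQ × EQ)) ∞
      (fun y => (⟨σ y, mfderiv ((𝓘(ℝ, EB).prod 𝓘(ℝ, EG)).prod 𝓘(ℝ, EB))
        (𝓘(ℝ, EQ).prod 𝓘(ℝ, EQ)) σ y (t.symm y u)⟩ :
          TangentBundle (𝓘(ℝ, EQ).prod 𝓘(ℝ, EQ)) (Q × Q))) y₀ := by
    have h1 := (hσ.contMDiffOn_tangentMapWithin (m := ∞) (by simp)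
      isOpen_liftDomain.uniqueMDiffOn).contMDiffAt
      (x := (⟨y₀, t.symm y₀ u⟩ : TangentBundle ((𝓘(ℝ, EB).prod 𝓘(ℝ, EG)).prod 𝓘(ℝ, EB)) _))
      (FiberBundle.continuous_proj _ _ |>.continuousAt.preimage_mem_nhds hU)
    refine (h1.comp y₀ hX).congr_of_eventuallyEq ?_
    filter_upwards [hU] with y hy
    exact congrArg (fun L : (EB × EG) × EB →L[ℝ] EQ × EQ =>
      (⟨σ y, L (t.symm y u)⟩ : TangentBundle (𝓘(ℝ, EQ).prod 𝓘(ℝ, EQ)) (Q × Q)))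
      (mfderivWithin_of_isOpen isOpen_liftDomain hy).symm
  have hσ₀ := hσ.contMDiffAt hU
  set δ : ConjugateBundle EQ G Q × MulAction.orbitRel.Quotient G Q → EQ × EQ := fun y =>
    (mfderiv ((𝓘(ℝ, EB).prod 𝓘(ℝ, EG)).prod 𝓘(ℝ, EB)) (𝓘(ℝ, EQ).prod 𝓘(ℝ, EQ)) σ y :
      (EB × EG) × EB →L[ℝ] EQ × EQ) (t.symm y u)
  have hfδ := contMDiffAt_of_trivial_section (IB := 𝓘(ℝ, EQ).prod 𝓘(ℝ, EQ)) (b := σ)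
    (s := fun y => f.toModel (σ y) (δ y))
    (((f.contMDiff (σ y₀)).comp y₀ hσ₀).clm_bundle_apply hδ)
  have hAδ := contMDiffAt_of_trivial_section (IB := 𝓘(ℝ, EQ).prod 𝓘(ℝ, EQ)) (b := σ)
    (s := fun y => 𝔄.toModel (σ y) (δ y))
    (((𝔄.form.contMDiff (σ y₀)).comp y₀ hσ₀).clm_bundle_apply hδ)
  have hg := ((contMDiff_generatorPairing (contMDiff_smul_prod EG EQ EB G Q) f).contMDiffAt.comp
    y₀ hσ₀).clm_apply hAδ
  -- near `y₀` the horizontal component is the total value on `Tσ u` minus the vertical component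
  refine (hfδ.sub hg).congr_of_eventuallyEq ?_
  filter_upwards [hU] with y hy
  have hy' : A.upsilon (σ y) = y := A.upsilon_localLift he hy
  have h1 := reducedHorizontal_add_reducedVertical (EB := EB) A 𝔄 hf hy' (δ y)
  rw [reducedVertical_fibreEquiv A 𝔄 hf hy'] at h1
  have h2 : A.dUpsilon EB (σ y) (δ y) = t.symm y u := by
    have hU' : liftDomain EQ e e' ∈ 𝓝 y := isOpen_liftDomain.mem_nhds hy
    have h3 := mfderiv_comp_model (A.mdifferentiableAt_upsilon EB (σ y))
      ((hσ.contMDiffAt hU').mdifferentiableAt (by simp)) rfl (t.symm y u)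
    have hid : (fun z => A.upsilon (σ z)) =ᶠ[𝓝 y] id := by
      filter_upwards [hU'] with z hz
      exact A.upsilon_localLift he hz
    rw [hid.mfderiv_eq] at h3
    exact h3.symm.trans
      (congrArg (fun L : (EB × EG) × EB →L[ℝ] (EB × EG) × EB => L (t.symm y u)) mfderiv_id)
  rw [h2] at h1
  exact eq_sub_of_add_eq h1

variable (EB) in
/-- The section of `T*(G̃ × Q/G) ⊕ ĝ*` determined by an equivariant `1`-form on `Q × Q`. -/
noncomputable def reducedSection [FiniteDimensional ℝ EG] [FiniteDimensional ℝ EB]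
    {f : OneForm (𝓘(ℝ, EQ).prod 𝓘(ℝ, EQ)) (Q × Q)} (hf : f.IsEquivariant G) :
    ReducedSection EB A where
  toFun y := (reducedHorizontal EB A 𝔄 f y, reducedVertical EB A f y)
  contMDiff_toFun y := contMDiffAt_prod_section
    (E := fun y : ConjugateBundle EQ G Q × MulAction.orbitRel.Quotient G Q =>
      TangentSpace ((𝓘(ℝ, EB).prod 𝓘(ℝ, EG)).prod 𝓘(ℝ, EB)) y →L[ℝ] Bundle.Trivial _ ℝ y)
    (E' := fun y => HatG EB A y →L[ℝ] Bundle.Trivial _ ℝ y)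
    (contMDiffAt_reducedHorizontal A 𝔄 hf y) (contMDiffAt_reducedVertical A 𝔄 hf y)

lemma reducedSection_pairing [FiniteDimensional ℝ EG] [FiniteDimensional ℝ EB]
    {f : OneForm (𝓘(ℝ, EQ).prod 𝓘(ℝ, EQ)) (Q × Q)} (hf : f.IsEquivariant G) (q : Q × Q)
    (δq : TangentSpace (𝓘(ℝ, EQ).prod 𝓘(ℝ, EQ)) q) :
    (reducedSection EB A 𝔄 hf).pairing (A.upsilon q) (A.tangentUpsilon EB q δq)
      (HatG.mk EB A q (𝔄.apply q δq)) = f q δq :=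
  reducedHorizontal_add_reducedVertical A 𝔄 hf rfl δq

/-- A section of `T*(G̃ × Q/G) ⊕ ĝ*` is determined by its pairings with the vectors
`TΥ(δq) ⊕ [q, 𝔄(δq)]`, since these exhaust the fibres. -/
lemma ReducedSection.ext_of_pairing {f₁ f₂ : ReducedSection EB A}
    (h : ∀ (q : Q × Q) (δq : TangentSpace (𝓘(ℝ, EQ).prod 𝓘(ℝ, EQ)) q),
      f₁.pairing (A.upsilon q) (A.tangentUpsilon EB q δq) (HatG.mk EB A q (𝔄.apply q δq)) =
        f₂.pairing (A.upsilon q) (A.tangentUpsilon EB q δq) (HatG.mk EB A q (𝔄.apply q δq))) :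
    f₁ = f₂ := by
  have key : ∀ y u η, f₁.pairing y u η = f₂.pairing y u η := by
    intro y u η
    obtain ⟨q, rfl⟩ := A.upsilon_surjective y
    obtain ⟨δq, ⟨rfl, rfl⟩, -⟩ := HatG.existsUnique_tangentUpsilon_eq A 𝔄 q u η
    exact h q δq
  refine ContMDiffSection.ext fun y => Prod.ext (ContinuousLinearMap.ext fun u => ?_)
    (ContinuousLinearMap.ext fun η => ?_)
  · simpa [ReducedSection.pairing] using key y u 0
  · simpa [ReducedSection.pairing] using key y 0 η

end Reduction

end DiscreteReduction

theorem mainTheorem6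
    {EG : Type*} [NormedAddCommGroup EG] [NormedSpace ℝ EG] [FiniteDimensional ℝ EG]
    {EQ : Type*} [NormedAddCommGroup EQ] [NormedSpace ℝ EQ] [FiniteDimensional ℝ EQ]
    {EB : Type*} [NormedAddCommGroup EB] [NormedSpace ℝ EB] [FiniteDimensional ℝ EB]
    {G : Type*} [Group G] [TopologicalSpace G] [ChartedSpace EG G] [LieGroup 𝓘(ℝ, EG) ∞ G]
    {Q : Type*} [TopologicalSpace Q] [ChartedSpace EQ Q] [IsManifold 𝓘(ℝ, EQ) ∞ Q]
    [MulAction G Q]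
    [ChartedSpace EB (MulAction.orbitRel.Quotient G Q)]
    [IsManifold 𝓘(ℝ, EB) ∞ (MulAction.orbitRel.Quotient G Q)]
    [IsPrincipalBundle EG EQ EB G Q]
    (A : AffineDiscreteConnection EG EQ G Q)
    (𝔄 : PrincipalConnection EG G (𝓘(ℝ, EQ).prod 𝓘(ℝ, EQ)) (Q × Q))
    (f : OneForm (𝓘(ℝ, EQ).prod 𝓘(ℝ, EQ)) (Q × Q)) (hf : f.IsEquivariant G) :
    (∃! fhat : ReducedSection EB A,
      ∀ (q : Q × Q) (δq : TangentSpace (𝓘(ℝ, EQ).prod 𝓘(ℝ, EQ)) q),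
        fhat.pairing (A.upsilon q) (A.tangentUpsilon EB q δq) (HatG.mk EB A q (𝔄.apply q δq)) =
          f q δq) ∧
    (∀ (q : Q × Q)
      (u : TangentSpace ((𝓘(ℝ, EB).prod 𝓘(ℝ, EG)).prod 𝓘(ℝ, EB)) (A.upsilon q))
      (η : HatG EB A (A.upsilon q)),
        ∃! δq : TangentSpace (𝓘(ℝ, EQ).prod 𝓘(ℝ, EQ)) q,
          A.tangentUpsilon EB q δq = u ∧ HatG.mk EB A q (𝔄.apply q δq) = η) := by
  refine ⟨⟨reducedSection EB A 𝔄 hf, reducedSection_pairing A 𝔄 hf, fun fhat h => ?_⟩,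
    HatG.existsUnique_tangentUpsilon_eq A 𝔄⟩
  exact ReducedSection.ext_of_pairing A 𝔄 fun q δq =>
    (h q δq).trans (reducedSection_pairing A 𝔄 hf q δq).symm
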